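/- Let $V$ be a finite-dimensional real vector space with a rational structure $V(\mathbb{Q})\subset V$ (the $\mathbb{Q}$-span of an $\mathbb{R}$-basis of $V$), and let $C\subset V$ be a nonempty open convex cone that is nondegenerate, i.e. contains no affine line. A lattice in $V(\mathbb{Q})$ is a finitely generated subgroup of $V(\mathbb{Q})$ of rank $\dim V$. Write $[Z]$ for the convex hull of a set $Z$, and put $C_+ := [\overline{C}\cap V(\mathbb{Q})]$. Let $C^\circ\subset V^*$ be the interior of the cone of linear forms that are $\ge 0$ on $C$; give $V^*$ the rational structure $V^*(\mathbb{Q})$ of the forms that take rational values on $V(\mathbb{Q})$, and put $C^\circ_+:=[\overline{C^\circ}\cap V^*(\mathbb{Q})]$. A polyhedral cone is a nonempty subset that is invariant under multiplication with positive scalars and can be defined by finitely many affine-linear inequalities. Let $\Gamma$ be a subgroup of $\mathrm{GL}(V)$ that stabilizes $C$ and some lattice in $V(\mathbb{Q})$. Then the following conditions are equivalent: (i) there exists a polyhedral cone $\Pi\subset C_+$ with $\Gamma\cdot\Pi = C_+$; (ii) there exists a polyhedral cone $\Pi\subset C_+$ with $\Gamma\cdot\Pi\supset C$; (iii) for every $\Gamma$-invariant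 lattice $L\subset V(\mathbb{Q})$, $\Gamma$ has finitely many orbits in the set of extreme points of $[C\cap L]$; (iv) for some $\Gamma$-invariant lattice $L\subset V(\mathbb{Q})$, $\Gamma$ has finitely many orbits in the set of extreme points of $[C\cap L]$; (i)$^*$–(iv)$^*$ the corresponding properties for the contragredient action $\xi\mapsto\xi\circ\gamma^{-1}$ of $\Gamma$ on $V^*$, with $V^*(\mathbb{Q})$, $C^\circ$ and $C^\circ_+$ in place of $V(\mathbb{Q})$, $C$ and $C_+$. Moreover, every polyhedral cone $\Pi\subset C_+$ with $\Gamma\cdot\Pi\supset C$ satisfies $\Gamma\cdot\Pi = C_+$. If these equivalent conditions are fulfilled, the pair $(C_+,\Gamma)$ is said to be of polyhedral type; thus $(C_+,\Gamma)$ is of polyhedral type if and only if $C^\circ_+$ with the contragredient action of $\Gamma$ is. -/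

import Mathlib

namespace PolyhedralPair

/-- `VQ` is a rational structure on the real vector space `V`: the `ℚ`-span of a real basis,
that is, the natural map from `ℝ ⊗ VQ` to `V` is an isomorphism. -/
def IsRationalStructure {V : Type*} [NormedAddCommGroup V] [NormedSpace ℝ V] [Module ℚ V]
    (VQ : Submodule ℚ V) : Prop :=
  ∃ b : Module.Basis (Fin (Module.finrank ℝ V)) ℝ V, VQ = Submodule.span ℚ (Set.range b)

/-- `L` is a lattice in `VQ`: a finitely generated subgroup of `VQ` of rank `dim V`, equivalently
the `ℤ`-span of a real basis of `V` that consists of elements of `VQ`. -/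
def IsLatticeIn {V : Type*} [NormedAddCommGroup V] [NormedSpace ℝ V] [Module ℚ V]
    (VQ : Submodule ℚ V) (L : Submodule ℤ V) : Prop :=
  ∃ b : Module.Basis (Fin (Module.finrank ℝ V)) ℝ V,
    (∀ i, b i ∈ VQ) ∧ L = Submodule.span ℤ (Set.range b)

/-- A cone: a nonempty subset that is invariant under multiplication with positive scalars
(it need not contain the origin). -/
def IsCone {V : Type*} [NormedAddCommGroup V] [NormedSpace ℝ V] (S : Set V) : Prop :=
  S.Nonempty ∧ ∀ c : ℝ, 0 < c → ∀ x ∈ S, c • x ∈ S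

/-- An open convex cone that is nondegenerate, i.e. contains no affine line. -/
structure IsOpenNondegenerateConvexCone {V : Type*} [NormedAddCommGroup V] [NormedSpace ℝ V]
    (C : Set V) : Prop where
  isCone : IsCone C
  isOpen : IsOpen C
  convex : Convex ℝ C
  nondegenerate : ¬ ∃ x v : V, v ≠ 0 ∧ ∀ t : ℝ, x + t • v ∈ C

/-- A polyhedron: a subset defined by finitely many affine-linear inequalities. -/
def IsPolyhedron {V : Type*} [NormedAddCommGroup V] [NormedSpace ℝ V] (S : Set V) : Prop :=
  ∃ s : Finset (V →ᵃ[ℝ] ℝ), S = {x | ∀ f ∈ s, 0 ≤ f x}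

/-- A polyhedral cone: a cone that is a polyhedron. -/
def IsPolyhedralCone {V : Type*} [NormedAddCommGroup V] [NormedSpace ℝ V] (S : Set V) : Prop :=
  IsCone S ∧ IsPolyhedron S

/-- The set `C₊`: the convex hull of the rational points of the closure of `C`. -/
def rationalHull {V : Type*} [NormedAddCommGroup V] [NormedSpace ℝ V] [Module ℚ V]
    (VQ : Submodule ℚ V) (C : Set V) : Set V :=
  convexHull ℝ (closure C ∩ (VQ : Set V))

/-- The open dual `C°`: the interior of the cone of linear forms that are nonnegative on `C`. -/
def openDual {V : Type*} [NormedAddCommGroup V] [NormedSpace ℝ V] (C : Set V) :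
    Set (StrongDual ℝ V) :=
  interior {ξ | ∀ x ∈ C, 0 ≤ ξ x}

/-- The dual rational structure: the linear forms that take rational values on `VQ`. -/
def dualRational {V : Type*} [NormedAddCommGroup V] [NormedSpace ℝ V] [Module ℚ V]
    (VQ : Submodule ℚ V) : Submodule ℚ (StrongDual ℝ V) where
  carrier := {ξ | ∀ v ∈ VQ, ∃ q : ℚ, ξ v = (q : ℝ)}
  zero_mem' := fun _ _ => ⟨0, by simp⟩
  add_mem' := fun {ξ η} hξ hη v hv => by
    obtain ⟨p, hp⟩ := hξ v hv
    obtain ⟨q, hq⟩ := hη v hv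
    exact ⟨p + q, by simp [hp, hq]⟩
  smul_mem' := fun c ξ hξ v hv => by
    obtain ⟨p, hp⟩ := hξ v hv
    exact ⟨c * p, by simp [hp, Rat.smul_def]⟩

/-- The contragredient action of `GL(V)` on the dual of `V`: `γ` sends `ξ` to `ξ ∘ γ⁻¹`. -/
noncomputable def contragredientHom (V : Type*) [NormedAddCommGroup V] [NormedSpace ℝ V] :
    (V ≃L[ℝ] V) →* (StrongDual ℝ V ≃L[ℝ] StrongDual ℝ V) where
  toFun γ := γ.arrowCongr (ContinuousLinearEquiv.refl ℝ ℝ)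
  map_one' := by ext ξ v; rfl
  map_mul' γ δ := by ext ξ v; rfl

/-- The image of `Γ` in `GL(V*)` under the contragredient action. -/
noncomputable def contragredient {V : Type*} [NormedAddCommGroup V] [NormedSpace ℝ V]
    (Γ : Subgroup (V ≃L[ℝ] V)) : Subgroup (StrongDual ℝ V ≃L[ℝ] StrongDual ℝ V) :=
  Γ.map (contragredientHom V)

/-- `Γ` stabilizes the subset `S` of `V`. -/
def Stabilizes {V : Type*} [NormedAddCommGroup V] [NormedSpace ℝ V]
    (Γ : Subgroup (V ≃L[ℝ] V)) (S : Set V) : Prop :=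
  ∀ γ ∈ Γ, γ '' S = S

/-- The set `Γ · S`, the union of all `Γ`-translates of `S`. -/
def translates {V : Type*} [NormedAddCommGroup V] [NormedSpace ℝ V]
    (Γ : Subgroup (V ≃L[ℝ] V)) (S : Set V) : Set V :=
  ⋃ γ ∈ Γ, γ '' S

/-- `Γ` has finitely many orbits in the set of extreme points of the convex hull of `C ∩ L`. -/
def FinitelyManyExtremeOrbits {V : Type*} [NormedAddCommGroup V] [NormedSpace ℝ V]
    (C : Set V) (L : Submodule ℤ V) (Γ : Subgroup (V ≃L[ℝ] V)) : Prop :=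
  {O : Set V | ∃ x ∈ Set.extremePoints ℝ (convexHull ℝ (C ∩ (L : Set V))),
    O = translates Γ {x}}.Finite

/-- The pair `(C₊, Γ)` is of polyhedral type: some polyhedral cone in `C₊` has all of `C₊` as
the union of its `Γ`-translates. -/
def IsOfPolyhedralType {V : Type*} [NormedAddCommGroup V] [NormedSpace ℝ V] [Module ℚ V]
    (VQ : Submodule ℚ V) (C : Set V) (Γ : Subgroup (V ≃L[ℝ] V)) : Prop :=
  ∃ P : Set V, IsPolyhedralCone P ∧ P ⊆ rationalHull VQ C ∧ translates Γ P = rationalHull VQ C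

/-- Some polyhedral cone in `C₊` has `Γ`-translates that cover `C`. -/
def HasCoveringCone {V : Type*} [NormedAddCommGroup V] [NormedSpace ℝ V] [Module ℚ V]
    (VQ : Submodule ℚ V) (C : Set V) (Γ : Subgroup (V ≃L[ℝ] V)) : Prop :=
  ∃ P : Set V, IsPolyhedralCone P ∧ P ⊆ rationalHull VQ C ∧ C ⊆ translates Γ P

/-- For every `Γ`-invariant lattice `L` in `VQ`, `Γ` has finitely many orbits in the set of
extreme points of `[C ∩ L]`. -/
def FiniteExtremeOrbitsForAll {V : Type*} [NormedAddCommGroup V] [NormedSpace ℝ V] [Module ℚ V]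
    (VQ : Submodule ℚ V) (C : Set V) (Γ : Subgroup (V ≃L[ℝ] V)) : Prop :=
  ∀ L : Submodule ℤ V, IsLatticeIn VQ L → Stabilizes Γ (L : Set V) →
    FinitelyManyExtremeOrbits C L Γ

/-- For some `Γ`-invariant lattice `L` in `VQ`, `Γ` has finitely many orbits in the set of
extreme points of `[C ∩ L]`. -/
def FiniteExtremeOrbitsForSome {V : Type*} [NormedAddCommGroup V] [NormedSpace ℝ V] [Module ℚ V]
    (VQ : Submodule ℚ V) (C : Set V) (Γ : Subgroup (V ≃L[ℝ] V)) : Prop :=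
  ∃ L : Submodule ℤ V, IsLatticeIn VQ L ∧ Stabilizes Γ (L : Set V) ∧
    FinitelyManyExtremeOrbits C L Γ

end PolyhedralPair

/-! Write L for an invariant lattice and N_e for the normal cone of a point e of C ∩ L, the set of
forms whose minimum on C ∩ L is attained at e.

(iv) implies (ii)*. A form in C° attains its minimum on C ∩ L at an extreme point of [C ∩ L]
(`exists_extreme_minimizer`), so the cones N_e of extreme points cover C°. The crux is that N_e is a
rational polyhedral cone: the differences x - e are the lattice points of the open convex
neighbourhood C - e of the origin, and the cone that these generate is finitely generated
(`exists_finset_generating_lattice_points`, by induction on the dimension). Its dual N_e is then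
generated by finitely many rational forms. Finitely many orbits of extreme points give finitely many
normal cones, and together these generate a covering cone for C°.

(ii) implies (iii). An extreme point can be moved into Π, which lies in a cone with finitely many
lattice generators g. A coefficient above 1 at some g ≠ 0 would make it the midpoint of two other
points of C ∩ L, so all coefficients are at most 1 and only finitely many lattice points remain.

(ii) implies (i), with the final assertion. A point of C has minimizers in the discrete set of dual
lattice points of C°. By Dickson's lemma only finitely many forms arise as minimizers over C ∩ K,
for K a cone generated by finitely many lattice points of the closure of C. As a form in C° has
finite stabilizer, finitely many elements of Γ suffice to carry Π onto points of C ∩ K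
(`finite_minimizers`, `finite_transporter`). A point of C₊ is a limit of points of C in one such K,
and it lies in a single closed translate of Π.

The same implications hold for C°, and V = V** leads back from (iv)* to (ii). -/

namespace PolyhedralPair

open PointedCone Filter Topology

/-! ### Polyhedral cones over a subfield: the Minkowski–Weyl theorem. -/

section MinkowskiWeyl

variable {E F : Type*} [AddCommGroup E] [Module ℝ E] [AddCommGroup F] [Module ℝ F]

/-- Fourier–Motzkin elimination of one parameter. -/
theorem exists_finset_fourierMotzkin (p : E →ₗ[ℝ] F →ₗ[ℝ] ℝ) (K : Subfield ℝ) (S : Set E)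
    (T : Set F) (hp : ∀ x ∈ S, ∀ y ∈ T, p x y ∈ K)
    (hT : ∀ y ∈ T, ∀ z ∈ T, ∀ a ∈ K, ∀ b ∈ K, a • y + b • z ∈ T)
    {g : E} (hg : g ∈ S) {H : Finset F} (hH : ↑H ⊆ T) :
    ∃ H' : Finset F, ↑H' ⊆ T ∧ ∀ x, (∀ y ∈ H', 0 ≤ p x y) ↔
      ∃ t : ℝ, 0 ≤ t ∧ ∀ y ∈ H, 0 ≤ p (x - t • g) y := by
  classical
  -- The combinations pair to zero with `g`, so they do not see `t`; their coefficients stay in `K`.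
  refine ⟨H.filter (fun y => 0 ≤ p g y) ∪
    ((H ×ˢ H).filter (fun yz => 0 < p g yz.1 ∧ p g yz.2 < 0)).image
      (fun yz => p g yz.1 • yz.2 + (-(p g yz.2)) • yz.1), ?_, fun x => ⟨fun h => ?_, ?_⟩⟩
  · intro y hy
    simp only [Finset.coe_union, Finset.coe_filter, Finset.coe_image, Set.mem_union,
      Set.mem_ofPred_eq, Set.mem_image, Finset.mem_product] at hy
    rcases hy with hy | ⟨⟨y, z⟩, ⟨⟨hy, hz⟩, _, _⟩, rfl⟩
    · exact hH hy.1
    · exact hT _ (hH hz) _ (hH hy) _ (hp g hg _ (hH hy)) _ (K.neg_mem (hp g hg _ (hH hz)))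
  · have h1 : ∀ y ∈ H, 0 ≤ p g y → 0 ≤ p x y := fun y hy hgy =>
      h y (Finset.mem_union_left _ (Finset.mem_filter.2 ⟨hy, hgy⟩))
    have h2 : ∀ y ∈ H, ∀ z ∈ H, 0 < p g y → p g z < 0 →
        0 ≤ p g y * p x z - p g z * p x y := fun y hy z hz hgy hgz => by
      have := h (p g y • z + (-(p g z)) • y) (Finset.mem_union_right _ (Finset.mem_image.2
        ⟨(y, z), Finset.mem_filter.2 ⟨Finset.mem_product.2 ⟨hy, hz⟩, hgy, hgz⟩, rfl⟩))
      simp only [map_add, map_smul, smul_eq_mul] at this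
      linarith
    -- Each `z` with `p g z < 0` bounds `t` below by `p x z / p g z`. The least admissible `t` is
    -- the largest such bound or 0, and the combined inequalities say that it respects every upper
    -- bound.
    let N := H.filter (fun y => p g y < 0)
    let V : Finset ℝ := insert 0 (N.image (fun z => p x z / p g z))
    have hV : V.Nonempty := ⟨0, Finset.mem_insert_self _ _⟩
    refine ⟨V.max' hV, V.le_max' 0 (Finset.mem_insert_self _ _), fun y hy => ?_⟩
    simp only [map_sub, map_smul, LinearMap.sub_apply, LinearMap.smul_apply, smul_eq_mul]
    rcases lt_trichotomy (p g y) 0 with hy0 | hy0 | hy0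
    · have : p x y / p g y ≤ V.max' hV := V.le_max' _ (Finset.mem_insert_of_mem
        (Finset.mem_image_of_mem _ (Finset.mem_filter.2 ⟨hy, hy0⟩)))
      rw [div_le_iff_of_neg hy0] at this
      linarith
    · rw [hy0, mul_zero, sub_zero]
      exact h1 y hy hy0.ge
    · have hm := V.max'_mem hV
      rcases Finset.mem_insert.1 hm with hm | hm
      · rw [hm, zero_mul, sub_zero]
        exact h1 y hy hy0.le
      · obtain ⟨z, hz, hze⟩ := Finset.mem_image.1 hm
        obtain ⟨hz, hz0⟩ := Finset.mem_filter.1 hz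
        rw [← hze]
        have h3 := h2 y hy z hz hy0 hz0
        have : p x z / p g z * p g y ≤ p x y := by
          rw [div_mul_eq_mul_div, div_le_iff_of_neg hz0]
          linarith
        linarith
  · rintro ⟨t, ht, h⟩ y hy
    have h' : ∀ y ∈ H, t * p g y ≤ p x y := fun y hy => by
      have := h y hy
      simp only [map_sub, map_smul, LinearMap.sub_apply, LinearMap.smul_apply,
        smul_eq_mul] at this
      linarith
    rcases Finset.mem_union.1 hy with hy | hy
    · obtain ⟨hy, hy0⟩ := Finset.mem_filter.1 hy
      exact (mul_nonneg ht hy0).trans (h' y hy)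
    · obtain ⟨⟨y, z⟩, hyz, rfl⟩ := Finset.mem_image.1 hy
      obtain ⟨hyz, hy0, hz0⟩ := Finset.mem_filter.1 hyz
      obtain ⟨hy, hz⟩ := Finset.mem_product.1 hyz
      simp only [map_add, map_smul, smul_eq_mul] at hy0 hz0 hy hz ⊢
      have := mul_le_mul_of_nonneg_left (h' z hz) hy0.le
      have := mul_le_mul_of_nonneg_left (h' y hy) (neg_nonneg.2 hz0.le)
      nlinarith

/-- A finitely generated cone is cut out by finitely many inequalities, with control on the field
of definition. -/
theorem exists_finset_mem_hull_iff (p : E →ₗ[ℝ] F →ₗ[ℝ] ℝ) (K : Subfield ℝ) (S : Set E)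
    (T : Set F) (hp : ∀ x ∈ S, ∀ y ∈ T, p x y ∈ K)
    (hT : ∀ y ∈ T, ∀ z ∈ T, ∀ a ∈ K, ∀ b ∈ K, a • y + b • z ∈ T)
    (h0 : ∃ H : Finset F, ↑H ⊆ T ∧ ∀ x, (∀ y ∈ H, 0 ≤ p x y) → x = 0)
    (G : Finset E) (hG : ↑G ⊆ S) :
    ∃ H : Finset F, ↑H ⊆ T ∧ ∀ x, x ∈ hull ℝ (G : Set E) ↔ ∀ y ∈ H, 0 ≤ p x y := by
  classical
  induction G using Finset.induction_on with
  | empty =>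
    obtain ⟨H, hH, h⟩ := h0
    refine ⟨H, hH, fun x => ⟨fun hx => ?_, fun hx => by rw [h x hx]; exact zero_mem _⟩⟩
    have : x = 0 := by simpa using hx
    simp [this]
  | insert g G _ ih =>
    rw [Finset.coe_insert, Set.insert_subset_iff] at hG
    obtain ⟨H, hH, h⟩ := ih hG.2
    -- Adjoining `g` to the generators projects along the ray of `g`, which is the elimination of
    -- one parameter.
    obtain ⟨H', hH', h'⟩ := exists_finset_fourierMotzkin p K S T hp hT hG.1 hH
    refine ⟨H', hH', fun x => ?_⟩
    rw [h', Finset.coe_insert, Submodule.mem_span_insert]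
    constructor
    · rintro ⟨c, z, hz, rfl⟩
      refine ⟨c, c.2, (h _).1 ?_⟩
      have : (c • g + z - (c : ℝ) • g) = z := by
        rw [show c • g = (c : ℝ) • g from rfl]; abel
      rwa [this]
    · rintro ⟨t, ht, hx⟩
      exact ⟨⟨t, ht⟩, _, (h _).2 hx, by
        rw [show (⟨t, ht⟩ : {c : ℝ // 0 ≤ c}) • g = t • g from rfl]; abel⟩

theorem nonneg_of_mem_hull {G : Set E} {f : E →ₗ[ℝ] ℝ} (hf : ∀ g ∈ G, 0 ≤ f g) {x : E}
    (hx : x ∈ hull ℝ G) : 0 ≤ f x := by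
  induction hx using Submodule.span_induction with
  | mem x h => exact hf x h
  | zero => simp
  | add x y _ _ hx hy => rw [map_add]; exact add_nonneg hx hy
  | smul a x _ hx =>
    rw [show a • x = (a : ℝ) • x from rfl, map_smul]
    exact mul_nonneg a.2 hx

/-- The solution set of finitely many inequalities is a finitely generated cone, with control on
the field of definition. -/
theorem exists_finset_forall_nonneg_iff (p : E →ₗ[ℝ] F →ₗ[ℝ] ℝ) (K : Subfield ℝ) (S : Set E)
    (T : Set F) (hp : ∀ x ∈ S, ∀ y ∈ T, p x y ∈ K)
    (hS : ∀ y ∈ S, ∀ z ∈ S, ∀ a ∈ K, ∀ b ∈ K, a • y + b • z ∈ S)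
    (hT : ∀ y ∈ T, ∀ z ∈ T, ∀ a ∈ K, ∀ b ∈ K, a • y + b • z ∈ T)
    (hS0 : ∃ G : Finset E, ↑G ⊆ S ∧ ∀ y, (∀ x ∈ G, 0 ≤ p x y) → y = 0)
    (hT0 : ∃ H : Finset F, ↑H ⊆ T ∧ ∀ x, (∀ y ∈ H, 0 ≤ p x y) → x = 0)
    (H : Finset F) (hH : ↑H ⊆ T) :
    ∃ G : Finset E, ↑G ⊆ S ∧ ∀ x, (∀ y ∈ H, 0 ≤ p x y) ↔ x ∈ hull ℝ (G : Set E) := by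
  -- Biduality: the inequalities `G` that describe the hull of `H` are the generators sought. Any
  -- form that is nonnegative on `G` lies in the hull of `H`, and this applies to the forms that cut
  -- out the hull of `G`.
  obtain ⟨G, hG, h⟩ := exists_finset_mem_hull_iff p.flip K T S (fun y hy x hx => hp x hx y hy)
    hS hS0 H hH
  refine ⟨G, hG, fun x => ⟨fun hx => ?_, fun hx y hy => ?_⟩⟩
  · obtain ⟨H', hH', h'⟩ := exists_finset_mem_hull_iff p K S T hp hT hT0 G hG
    rw [h']
    intro y hy
    refine nonneg_of_mem_hull (f := p x) hx ((h y).2 fun g hg => ?_)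
    exact (h' g).1 (subset_hull hg) y hy
  · exact nonneg_of_mem_hull (f := p.flip y) (fun g hg => (h y).1 (subset_hull hy) g hg) hx

end MinkowskiWeyl

/-! ### Polyhedral cones in a normed space. -/

section Normed

variable {V : Type*} [NormedAddCommGroup V] [NormedSpace ℝ V]

/-- The evaluation pairing between a space and its dual. -/
noncomputable def evalPairing (V : Type*) [NormedAddCommGroup V] [NormedSpace ℝ V] :
    V →ₗ[ℝ] StrongDual ℝ V →ₗ[ℝ] ℝ :=
  (topDualPairing ℝ V).flip

@[simp] theorem evalPairing_apply (x : V) (ξ : StrongDual ℝ V) : evalPairing V x ξ = ξ x := rfl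

theorem exists_finset_points_eq_zero {ι : Type*} [Fintype ι] (b : Module.Basis ι ℝ V)
    (S : Set V) (hS : ∀ i, b i ∈ S) (hS' : ∀ i, -b i ∈ S) :
    ∃ G : Finset V, ↑G ⊆ S ∧ ∀ y, (∀ x ∈ G, 0 ≤ evalPairing V x y) → y = 0 := by
  classical
  refine ⟨Finset.univ.image b ∪ Finset.univ.image (fun i => -b i), ?_, fun y hy => ?_⟩
  · intro y hy
    simp only [Finset.coe_union, Finset.coe_image, Finset.coe_univ, Set.image_univ,
      Set.mem_union, Set.mem_range] at hy
    rcases hy with ⟨i, rfl⟩ | ⟨i, rfl⟩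
    exacts [hS i, hS' i]
  · refine ContinuousLinearMap.coe_injective (b.ext fun i => ?_)
    have h1 := hy _ (Finset.mem_union_left _ (Finset.mem_image_of_mem b (Finset.mem_univ i)))
    have h2 := hy _ (Finset.mem_union_right _
        (Finset.mem_image_of_mem (fun i => -b i) (Finset.mem_univ i)))
    rw [evalPairing_apply] at h1 h2
    rw [map_neg] at h2
    simp only [ContinuousLinearMap.coe_coe, ContinuousLinearMap.toLinearMap_zero, LinearMap.zero_apply]
    linarith

variable [FiniteDimensional ℝ V]

/-- The coordinate forms of a basis, as continuous linear forms. -/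
noncomputable def coordL {ι : Type*} (b : Module.Basis ι ℝ V) (i : ι) : StrongDual ℝ V :=
  LinearMap.toContinuousLinearMap (b.coord i)

@[simp] theorem coordL_apply {ι : Type*} (b : Module.Basis ι ℝ V) (i : ι) (x : V) :
    coordL b i x = b.repr x i := rfl

/-- A dual separating set of coordinate forms of either sign. -/
theorem eq_zero_of_forall_coord_nonneg {ι : Type*} [Fintype ι] (b : Module.Basis ι ℝ V)
    (x : V) (h : ∀ i, 0 ≤ coordL b i x ∧ 0 ≤ (-coordL b i) x) : x = 0 := by
  refine b.ext_elem fun i => ?_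
  have := h i
  simp at this
  simp
  linarith

theorem exists_finset_forms_eq_zero {ι : Type*} [Fintype ι] (b : Module.Basis ι ℝ V)
    (T : Set (StrongDual ℝ V)) (hT : ∀ i, coordL b i ∈ T) (hT' : ∀ i, -coordL b i ∈ T) :
    ∃ H : Finset (StrongDual ℝ V), ↑H ⊆ T ∧
      ∀ x, (∀ y ∈ H, 0 ≤ evalPairing V x y) → x = 0 := by
  classical
  refine ⟨Finset.univ.image (coordL b) ∪ Finset.univ.image (fun i => -coordL b i), ?_,
    fun x hx => ?_⟩
  · intro y hy
    simp only [Finset.coe_union, Finset.coe_image, Finset.coe_univ, Set.image_univ,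
      Set.mem_union, Set.mem_range] at hy
    rcases hy with ⟨i, rfl⟩ | ⟨i, rfl⟩
    exacts [hT i, hT' i]
  · refine eq_zero_of_forall_coord_nonneg b x fun i => ⟨?_, ?_⟩
    · exact hx _ (Finset.mem_union_left _ (Finset.mem_image_of_mem _ (Finset.mem_univ i)))
    · exact hx _ (Finset.mem_union_right _
        (Finset.mem_image_of_mem (fun i => -coordL b i) (Finset.mem_univ i)))

theorem exists_finset_forms_of_hull (G : Finset V) :
    ∃ H : Finset (StrongDual ℝ V), ∀ x, x ∈ hull ℝ (G : Set V) ↔ ∀ ξ ∈ H, 0 ≤ ξ x := by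
  obtain ⟨H, -, h⟩ := exists_finset_mem_hull_iff (evalPairing V) ⊤ Set.univ Set.univ
    (fun _ _ _ _ => trivial) (fun _ _ _ _ _ _ _ _ => trivial)
    (exists_finset_forms_eq_zero (Module.finBasis ℝ V) _ (fun _ => trivial) fun _ => trivial)
    G (Set.subset_univ _)
  exact ⟨H, h⟩

theorem exists_finset_points_of_forms (H : Finset (StrongDual ℝ V)) :
    ∃ G : Finset V, ∀ x, (∀ ξ ∈ H, 0 ≤ ξ x) ↔ x ∈ hull ℝ (G : Set V) := by
  obtain ⟨G, -, h⟩ := exists_finset_forall_nonneg_iff (evalPairing V) ⊤ Set.univ Set.univ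
    (fun _ _ _ _ => trivial) (fun _ _ _ _ _ _ _ _ => trivial) (fun _ _ _ _ _ _ _ _ => trivial)
    (exists_finset_points_eq_zero (Module.finBasis ℝ V) _ (fun _ => trivial) fun _ => trivial)
    (exists_finset_forms_eq_zero (Module.finBasis ℝ V) _ (fun _ => trivial) fun _ => trivial)
    H (Set.subset_univ _)
  exact ⟨G, h⟩

theorem isClosed_hull_finset (G : Finset V) : IsClosed (hull ℝ (G : Set V) : Set V) := by
  obtain ⟨H, h⟩ := exists_finset_forms_of_hull G
  have : (hull ℝ (G : Set V) : Set V) = ⋂ ξ ∈ H, {x | 0 ≤ ξ x} := by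
    ext x; simp [h]
  rw [this]
  exact isClosed_biInter fun ξ _ => isClosed_le continuous_const ξ.continuous

theorem isPolyhedralCone_hull_finset (G : Finset V) :
    IsPolyhedralCone (hull ℝ (G : Set V) : Set V) := by
  classical
  refine ⟨⟨⟨0, zero_mem _⟩, fun c hc x hx => ?_⟩, ?_⟩
  · exact (hull ℝ (G : Set V)).smul_mem hc.le hx
  · obtain ⟨H, h⟩ := exists_finset_forms_of_hull G
    refine ⟨H.image (fun ξ => (ξ : V →ₗ[ℝ] ℝ).toAffineMap), ?_⟩
    ext x
    simp [h]

/-- Scale invariance makes the affine inequalities linear: large multiples of a point force the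
linear part to be nonnegative there, and small multiples of one point force the constant term to be
nonnegative. In particular `P` is closed and contains the origin. -/
theorem IsPolyhedralCone.exists_eq_hull {P : Set V} (hP : IsPolyhedralCone P) :
    ∃ G : Finset V, P = hull ℝ (G : Set V) := by
  classical
  obtain ⟨⟨⟨x₀, hx₀⟩, hc⟩, s, hs⟩ := hP
  obtain ⟨G, hG⟩ := exists_finset_points_of_forms
    (s.image fun f => LinearMap.toContinuousLinearMap f.linear)
  have hdec : ∀ (f : V →ᵃ[ℝ] ℝ) x, f x = f.linear x + f 0 := fun f x => by
    simpa using f.map_vadd 0 x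
  refine ⟨G, ?_⟩
  ext x
  rw [SetLike.mem_coe, ← hG]
  simp only [Finset.mem_image, forall_exists_index, and_imp, forall_apply_eq_imp_iff₂,
    LinearMap.coe_toContinuousLinearMap']
  constructor
  · intro hx f hf
    by_contra! hneg
    have key : ∀ c : ℝ, 0 < c → 0 ≤ c * f.linear x + f 0 := fun c hc' => by
      have := hc c hc' x hx
      rw [hs] at this
      have := this f hf
      rw [hdec, map_smul, smul_eq_mul] at this
      exact this
    have h1 := key ((|f 0| + 1) / -f.linear x) (div_pos (by positivity) (by linarith))
    have : (|f 0| + 1) / -f.linear x * f.linear x = -(|f 0| + 1) := by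
      have := hneg.ne
      field_simp
    rw [this] at h1
    linarith [le_abs_self (f 0)]
  · intro hx
    rw [hs]
    intro f hf
    have h0 : 0 ≤ f 0 := by
      by_contra! hneg
      have key : ∀ c : ℝ, 0 < c → 0 ≤ c * f.linear x₀ + f 0 := fun c hc' => by
        have := hc c hc' x₀ hx₀
        rw [hs] at this
        have := this f hf
        rw [hdec, map_smul, smul_eq_mul] at this
        exact this
      have h1 := key (-f 0 / (2 * (|f.linear x₀| + 1))) (div_pos (by linarith) (by positivity))
      have h2 : -f 0 / (2 * (|f.linear x₀| + 1)) * f.linear x₀ ≤ -f 0 / 2 := by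
        rw [div_mul_eq_mul_div, div_le_div_iff₀ (by positivity) (by norm_num)]
        nlinarith [le_abs_self (f.linear x₀)]
      linarith
    rw [hdec]
    exact add_nonneg (hx f hf) h0

end Normed

/-! ### Closed subgroups without lines. -/

section ClosedSubgroup

variable {V : Type*} [NormedAddCommGroup V] [NormedSpace ℝ V] [FiniteDimensional ℝ V]

/-- A closed subgroup that contains no line is discrete. -/
theorem exists_pos_forall_norm_lt_eq_zero (H : AddSubgroup V) (hH : IsClosed (H : Set V))
    (hline : ∀ w : V, (∀ t : ℝ, t • w ∈ H) → w = 0) :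
    ∃ δ > 0, ∀ h ∈ H, ‖h‖ < δ → h = 0 := by
  by_contra! hcon
  choose h hmem hlt hne using fun n : ℕ => hcon (1 / ((n : ℝ) + 1)) (by positivity)
  have hsph : ∀ n, ‖h n‖⁻¹ • h n ∈ Metric.sphere (0 : V) 1 := fun n => by
    simp [norm_smul, inv_mul_cancel₀ (norm_ne_zero_iff.2 (hne n))]
  obtain ⟨u, hu, φ, hφ, hlim⟩ := (isCompact_sphere (0 : V) 1).tendsto_subseq hsph
  have hnorm : Tendsto (fun n => ‖h (φ n)‖) atTop (𝓝 0) := by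
    have h1 : Tendsto (fun n : ℕ => 1 / ((n : ℝ) + 1)) atTop (𝓝 0) :=
      tendsto_one_div_add_atTop_nhds_zero_nat
    exact squeeze_zero (fun n => norm_nonneg _) (fun n => (hlt (φ n)).le)
      (h1.comp hφ.tendsto_atTop)
  have : u = 0 := by
    refine hline u fun t => ?_
    -- Rounding the multiple to an integer costs at most the length of `h (φ n)`, which tends to
    -- zero, so the closed group contains the whole line in the limit direction.
    have hd : ∀ n, ‖(⌊t * ‖h (φ n)‖⁻¹⌋ : ℤ) • h (φ n) - t • (‖h (φ n)‖⁻¹ • h (φ n))‖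
        ≤ ‖h (φ n)‖ := fun n => by
      rw [smul_smul, ← Int.cast_smul_eq_zsmul ℝ, ← sub_smul, norm_smul]
      refine mul_le_of_le_one_left (norm_nonneg _) ?_
      rw [Real.norm_eq_abs, abs_le]
      constructor <;> linarith [Int.floor_le (t * ‖h (φ n)‖⁻¹),
        Int.lt_floor_add_one (t * ‖h (φ n)‖⁻¹)]
    have h2 := squeeze_zero_norm hd hnorm
    have h3 : Tendsto (fun n => (⌊t * ‖h (φ n)‖⁻¹⌋ : ℤ) • h (φ n)) atTop (𝓝 (t • u)) := by
      have := h2.add (hlim.const_smul t)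
      simpa using this
    exact hH.mem_of_tendsto h3 (Eventually.of_forall fun n => H.zsmul_mem (hmem _) _)
  simp [this] at hu

theorem finite_inter_closedBall_of_no_line (H : AddSubgroup V) (hH : IsClosed (H : Set V))
    (hline : ∀ w : V, (∀ t : ℝ, t • w ∈ H) → w = 0) (R : ℝ) :
    ((H : Set V) ∩ Metric.closedBall 0 R).Finite := by
  obtain ⟨δ, hδ, h⟩ := exists_pos_forall_norm_lt_eq_zero H hH hline
  rw [Set.inter_comm]
  refine Metric.finite_isBounded_inter_isClosed ?_ Metric.isBounded_closedBall hH
  have : DiscreteTopology H := by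
    rw [discreteTopology_iff_isOpen_singleton_zero, Metric.isOpen_singleton_iff]
    refine ⟨δ, hδ, fun y hy => Subtype.ext (h y y.2 ?_)⟩
    simpa [dist_eq_norm] using hy
  exact DiscreteTopology.isDiscrete

end ClosedSubgroup

/-! ### Return of rays to a cocompact subgroup. -/

section Recurrence

variable {V : Type*} [NormedAddCommGroup V] [NormedSpace ℝ V] [FiniteDimensional ℝ V]

/-- A ray returns arbitrarily close to a cocompact subgroup at arbitrarily late times. -/
theorem exists_norm_sub_smul_lt (L : AddSubgroup V) {R : ℝ} (hR : ∀ v, ∃ l ∈ L, ‖v - l‖ ≤ R)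
    (u : V) (T : ℝ) {ε : ℝ} (hε : 0 < ε) : ∃ l ∈ L, ∃ t : ℝ, T ≤ t ∧ ‖l - t • u‖ < ε := by
  let N : ℝ := max T 0
  -- Pigeonhole on the bounded remainders `(n * N) • u - l n`: two close remainders give a lattice
  -- point near a multiple of `u` by at least `N`.
  choose l hl hlR using fun n : ℕ => hR ((n * N) • u)
  obtain ⟨x, -, φ, hφ, hlim⟩ := (isCompact_closedBall (0 : V) R).tendsto_subseq
    (x := fun n : ℕ => ((n * N) • u) - l n) (fun n => by simpa using hlR n)
  obtain ⟨k, hk⟩ := Metric.cauchySeq_iff'.1 hlim.cauchySeq ε hε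
  have h1 := hk (k + 1) (Nat.le_succ k)
  have hlt : φ k < φ (k + 1) := hφ (Nat.lt_succ_self k)
  refine ⟨l (φ (k + 1)) - l (φ k), L.sub_mem (hl _) (hl _),
    ((φ (k + 1) : ℝ) - φ k) * N, ?_, ?_⟩
  · have h2 : (1 : ℝ) ≤ (φ (k + 1) : ℝ) - φ k := by
      have : ((φ k + 1 : ℕ) : ℝ) ≤ φ (k + 1) := Nat.cast_le.2 hlt
      push_cast at this
      linarith
    calc T ≤ N := le_max_left _ _
      _ = 1 * N := (one_mul _).symm
      _ ≤ _ := mul_le_mul_of_nonneg_right h2 (le_max_right _ _)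
  · rw [dist_eq_norm, ← norm_neg] at h1
    have h2 : l (φ (k + 1)) - l (φ k) - (((φ (k + 1) : ℝ) - φ k) * N) • u =
        -((((φ (k + 1) : ℝ) * N) • u - l (φ (k + 1))) - ((((φ k : ℝ) * N) • u) - l (φ k))) := by
      rw [sub_mul, sub_smul]
      abel
    rw [h2]
    exact h1

/-- The closure of the subgroup generated by `L` and the line spanned by `u`. -/
def lineClosure (L : AddSubgroup V) (u : V) : AddSubgroup V :=
  (L ⊔ (Submodule.span ℝ {u}).toAddSubgroup).topologicalClosure

omit [FiniteDimensional ℝ V] in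
theorem exists_near_of_mem_lineClosure {L : AddSubgroup V} {u h : V} (hh : h ∈ lineClosure L u)
    {ε : ℝ} (hε : 0 < ε) : ∃ l ∈ L, ∃ t : ℝ, ‖l - t • u - h‖ < ε := by
  have : h ∈ closure ((L ⊔ (Submodule.span ℝ {u}).toAddSubgroup : AddSubgroup V) : Set V) := hh
  obtain ⟨z, hz, hd⟩ := Metric.mem_closure_iff.1 this ε hε
  obtain ⟨l, hl, y, hy, rfl⟩ := AddSubgroup.mem_sup.1 hz
  obtain ⟨t, rfl⟩ := Submodule.mem_span_singleton.1 hy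
  refine ⟨l, hl, -t, ?_⟩
  rw [dist_comm, dist_eq_norm] at hd
  simpa using hd

/-- A negative parameter is repaired by adding a later return of the ray to `L`. The sign matters
because only forward translation along a recession direction preserves `D`. -/
theorem exists_near_nonneg_of_mem_lineClosure {L : AddSubgroup V} {R : ℝ}
    (hR : ∀ v, ∃ l ∈ L, ‖v - l‖ ≤ R) {u h : V} (hh : h ∈ lineClosure L u)
    {ε : ℝ} (hε : 0 < ε) : ∃ l ∈ L, ∃ t : ℝ, 0 ≤ t ∧ ‖l - t • u - h‖ < ε := by
  obtain ⟨l, hl, s, hs⟩ := exists_near_of_mem_lineClosure hh (half_pos hε)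
  obtain ⟨l', hl', t, ht, hlt⟩ := exists_norm_sub_smul_lt L hR u (-s) (half_pos hε)
  refine ⟨l + l', L.add_mem hl hl', s + t, by linarith, ?_⟩
  have : l + l' - (s + t) • u - h = (l - s • u - h) + (l' - t • u) := by
    rw [add_smul]; abel
  rw [this]
  exact (norm_add_le _ _).trans_lt (by linarith)

omit [FiniteDimensional ℝ V] in
theorem le_lineClosure (L : AddSubgroup V) (u : V) : L ≤ lineClosure L u :=
  le_sup_left.trans (AddSubgroup.le_topologicalClosure _)

omit [FiniteDimensional ℝ V] in
theorem smul_mem_lineClosure (L : AddSubgroup V) (u : V) (t : ℝ) : t • u ∈ lineClosure L u :=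
  AddSubgroup.le_topologicalClosure _ ((le_sup_right : _ ≤ L ⊔ _)
    (Submodule.smul_mem _ t (Submodule.mem_span_singleton_self u)))

/-- The largest linear subspace contained in a subgroup. -/
def maxSubspace (H : AddSubgroup V) : Submodule ℝ V where
  carrier := {w | ∀ t : ℝ, t • w ∈ H}
  zero_mem' := fun t => by simp
  add_mem' := fun {a b} ha hb t => by rw [smul_add]; exact H.add_mem (ha t) (hb t)
  smul_mem' := fun c x hx t => by rw [smul_smul]; exact hx _

omit [FiniteDimensional ℝ V] in
theorem mem_of_mem_maxSubspace {H : AddSubgroup V} {w : V} (hw : w ∈ maxSubspace H) : w ∈ H := by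
  simpa using hw 1

end Recurrence

/-! ### Recession directions of open convex sets. -/

section Recession

variable {V : Type*} [NormedAddCommGroup V] [NormedSpace ℝ V]

/-- The point is `s • (s⁻¹ • d) + (1 - s) • ((t / (1 - s)) • u)`, where openness keeps `s⁻¹ • d` in
`D` for `s` slightly below 1. -/
theorem add_smul_mem_of_recession {D : Set V} (hconv : Convex ℝ D) (hopen : IsOpen D) {u : V}
    (hu : ∀ t : ℝ, 0 < t → t • u ∈ closure D) {d : V} (hd : d ∈ D) {t : ℝ} (ht : 0 ≤ t) :
    d + t • u ∈ D := by
  rcases ht.eq_or_lt with rfl | ht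
  · simpa using hd
  have hcont : Tendsto (fun s : ℝ => s⁻¹ • d) (𝓝[<] 1) (𝓝 d) := by
    have : Tendsto (fun s : ℝ => s⁻¹ • d) (𝓝 1) (𝓝 ((1 : ℝ)⁻¹ • d)) :=
      ((tendsto_inv₀ one_ne_zero).smul_const d)
    rw [inv_one, one_smul] at this
    exact this.mono_left nhdsWithin_le_nhds
  have hev : ∀ᶠ s : ℝ in 𝓝[<] 1, s⁻¹ • d ∈ D := hcont (hopen.mem_nhds hd)
  have hev2 : ∀ᶠ s : ℝ in 𝓝[<] 1, s ∈ Set.Ioo (0 : ℝ) 1 := Ioo_mem_nhdsLT one_pos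
  obtain ⟨s, hs, hs0, hs1⟩ := (hev.and hev2).exists
  have h1 := hconv.combo_interior_closure_mem_interior (x := s⁻¹ • d) (y := (t / (1 - s)) • u)
    (by rwa [hopen.interior_eq]) (hu _ (div_pos ht (by linarith))) hs0 (sub_nonneg.2 hs1.le)
    (by ring)
  rw [hopen.interior_eq, smul_smul, smul_smul, mul_inv_cancel₀ hs0.ne', one_smul,
    mul_div_cancel₀ _ (by linarith)] at h1
  exact h1

theorem norm_lt_of_smul_notMem_closure {D : Set V} (hconv : Convex ℝ D) (h0 : (0 : V) ∈ D)
    {x : V} (hx : x ∈ D) (hx0 : x ≠ 0) {t : ℝ} (ht : 0 < t)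
    (hn : t • (‖x‖⁻¹ • x) ∉ closure D) : ‖x‖ < t := by
  by_contra! hle
  apply hn
  have hpos : 0 < ‖x‖ := norm_pos_iff.2 hx0
  apply subset_closure
  rw [smul_smul]
  refine hconv.smul_mem_of_zero_mem h0 hx ⟨by positivity, ?_⟩
  rw [← div_eq_mul_inv, div_le_one hpos]
  exact hle

end Recession

/-! ### Finite generation near a recession direction. -/

section LocalStep

variable {V : Type*} [NormedAddCommGroup V] [NormedSpace ℝ V] [FiniteDimensional ℝ V]

/-- If every nonzero form that is not positive at `u` is negative somewhere on `X`, then finitely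
many points of `X` witness this. -/
theorem exists_finset_forall_eq_zero (X : Set V) (u : V)
    (hX : ∀ f : StrongDual ℝ V, f ≠ 0 → f u ≤ 0 → ∃ l ∈ X, f l < 0) :
    ∃ G : Finset V, ↑G ⊆ X ∧ ∀ f : StrongDual ℝ V, (∀ g ∈ G, 0 ≤ f g) → f u ≤ 0 → f = 0 := by
  classical
  have hproper : ProperSpace (StrongDual ℝ V) := FiniteDimensional.proper ℝ (StrongDual ℝ V)
  let S : Set (StrongDual ℝ V) := Metric.sphere 0 1 ∩ {f | f u ≤ 0}
  have happ : ∀ x : V, Continuous fun f : StrongDual ℝ V => f x := fun x =>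
    (ContinuousLinearMap.apply ℝ ℝ x).continuous
  have hS : IsCompact S := (isCompact_sphere 0 1).inter_right
    (isClosed_le (happ _) continuous_const)
  obtain ⟨t, ht⟩ := hS.elim_finite_subcover (fun l : X => {f : StrongDual ℝ V | f l.1 < 0})
    (fun l => isOpen_lt (happ _) continuous_const) (by
      -- Compactness of the unit forms that are nonpositive at `u`; rescaling reaches all nonzero
      -- ones.
      rintro f ⟨hf1, hfu⟩
      have hf0 : f ≠ 0 := by
        rintro rfl
        simp at hf1
      obtain ⟨l, hl, hfl⟩ := hX f hf0 hfu
      exact Set.mem_iUnion.2 ⟨⟨l, hl⟩, hfl⟩)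
  refine ⟨t.image Subtype.val, ?_, fun f hf hfu => ?_⟩
  · intro x hx
    obtain ⟨l, -, rfl⟩ := Finset.mem_image.1 (Finset.mem_coe.1 hx)
    exact l.2
  · by_contra hf'
    have hpos : 0 < ‖f‖ := norm_pos_iff.2 hf'
    have hmem : ‖f‖⁻¹ • f ∈ S := by
      refine ⟨by simp [norm_smul, inv_mul_cancel₀ hpos.ne'], ?_⟩
      change ‖f‖⁻¹ * f u ≤ 0
      exact mul_nonpos_of_nonneg_of_nonpos (by positivity) hfu
    obtain ⟨l, hl⟩ := Set.mem_iUnion.1 (ht hmem)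
    obtain ⟨hlt, hl0⟩ := Set.mem_iUnion.1 hl
    have : 0 ≤ ‖f‖⁻¹ * f l.1 := mul_nonneg (by positivity)
      (hf _ (Finset.mem_image_of_mem Subtype.val hlt))
    exact absurd hl0 (not_lt.2 this)

/-- Finitely many lattice points of `D` in the subspace `W` suffice to force a form that is
nonnegative on them, but not positive at `u`, to vanish on `W`. -/
theorem exists_finset_forces_vanishing (W : Submodule ℝ V) (X : Set V) (u : V) (hu : u ∈ W)
    {r : ℝ} (hr : 0 < r)
    (hX : ∀ w ∈ W, ‖w‖ < r → ∀ ε > 0, ∃ l ∈ X, l ∈ W ∧ ∃ t : ℝ, 0 ≤ t ∧ ‖l - t • u - w‖ < ε) :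
    ∃ G : Finset V, ↑G ⊆ X ∧ ∀ f : StrongDual ℝ V, (∀ g ∈ G, 0 ≤ f g) → f u ≤ 0 →
      ∀ w ∈ W, f w = 0 := by
  classical
  obtain ⟨G, hG, h⟩ := exists_finset_forall_eq_zero (V := W) (Subtype.val ⁻¹' X) ⟨u, hu⟩ (by
    intro f hf0 hfu
    obtain ⟨w, hw⟩ : ∃ w : W, f w < 0 := by
      by_contra! hcon
      refine hf0 (ContinuousLinearMap.ext fun w => le_antisymm ?_ (hcon w))
      have := hcon (-w)
      rw [map_neg] at this
      simpa using this
    have hwr : ∃ c : ℝ, 0 < c ∧ ‖c • w‖ < r := by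
      refine ⟨r / (‖w‖ + 1), by positivity, ?_⟩
      rw [norm_smul, Real.norm_of_nonneg (by positivity), div_mul_eq_mul_div,
        div_lt_iff₀ (by positivity)]
      nlinarith [norm_nonneg w]
    obtain ⟨c, hc, hcr⟩ := hwr
    have hcw : f (c • w) < 0 := by
      rw [map_smul, smul_eq_mul]
      exact mul_neg_of_pos_of_neg hc hw
    -- The point `l` is close to `c • w + s • u`, where `f` is at most `f (c • w) < 0`; the
    -- tolerance keeps `f l` negative.
    obtain ⟨l, hlX, hlW, s, hs, hls⟩ := hX (c • w : W) (c • w).2 hcr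
      (-f (c • w) / (‖f‖ + 1)) (div_pos (by linarith) (by positivity))
    refine ⟨⟨l, hlW⟩, hlX, ?_⟩
    have hle : f (⟨l, hlW⟩ - s • ⟨u, hu⟩ - c • w) ≤ ‖f‖ * ‖l - s • u - (c • w : W)‖ :=
      (le_abs_self _).trans (f.le_opNorm (⟨l, hlW⟩ - s • ⟨u, hu⟩ - c • w))
    rw [lt_div_iff₀ (by positivity)] at hls
    rw [map_sub, map_sub, map_smul, smul_eq_mul] at hle
    have hsu : s * f ⟨u, hu⟩ ≤ 0 := mul_nonpos_of_nonneg_of_nonpos hs hfu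
    nlinarith [norm_nonneg (l - s • u - (c • w : W))])
  refine ⟨G.image Subtype.val, ?_, fun f hf hfu w hw => ?_⟩
  · intro x hx
    obtain ⟨l, hl, rfl⟩ := Finset.mem_image.1 (Finset.mem_coe.1 hx)
    exact hG hl
  · have := h (f.comp W.subtypeL) (fun g hg => hf _ (Finset.mem_image_of_mem _ hg)) hfu
    exact DFunLike.congr_fun this ⟨w, hw⟩

/-- Near a recession direction the lattice points of `D` generate a finitely generated cone, as
soon as this holds for the projection to a complement of `W`. -/
theorem exists_local_generators (W : Submodule ℝ V) (X : Set V) (u : V) (hu : u ∈ W)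
    {W' : Type*} [AddCommGroup W'] [Module ℝ W'] (π : V →ₗ[ℝ] W')
    (hπ : ∀ x, π x = 0 ↔ x ∈ W) {r : ℝ} (hr : 0 < r)
    (hX : ∀ w ∈ W, ‖w‖ < r → ∀ ε > 0, ∃ l ∈ X, l ∈ W ∧ ∃ t : ℝ, 0 ≤ t ∧ ‖l - t • u - w‖ < ε)
    (hquot : ∃ G : Finset W', ↑G ⊆ π '' X ∧ π '' X ⊆ hull ℝ (G : Set W')) :
    ∃ G : Finset V, ↑G ⊆ X ∧ ∃ U : Set V, IsOpen U ∧ u ∈ U ∧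
      ∀ x ∈ X, ∀ c : ℝ, 0 < c → c • x ∈ U → x ∈ hull ℝ (G : Set V) := by
  classical
  obtain ⟨G₁, hG₁, hG₁'⟩ := exists_finset_forces_vanishing W X u hu hr hX
  obtain ⟨G₂, hG₂, hG₂'⟩ := hquot
  obtain ⟨G₃, hG₃, rfl⟩ := Finset.subset_set_image_iff.1 hG₂
  obtain ⟨F, hF⟩ := exists_finset_forms_of_hull (G₁ ∪ G₃)
  -- Defining inequalities that are positive at `u` stay so nearby. Each remaining one vanishes on
  -- `W` because of `G₁`, so it is tested in the quotient, where `G₃` generates.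
  refine ⟨G₁ ∪ G₃, by simp [hG₁, hG₃], ⋂ f ∈ F, {v | 0 < f u → 0 < f v}, ?_, ?_, ?_⟩
  · refine isOpen_biInter_finset fun f _ => ?_
    by_cases hfu : 0 < f u
    · simpa [hfu] using isOpen_lt continuous_const f.continuous
    · simp [hfu]
  · simp
  · intro x hx c hc hxU
    rw [hF]
    intro f hf
    by_cases hfu : 0 < f u
    · have := (Set.mem_iInter₂.1 hxU f hf) hfu
      rw [map_smul, smul_eq_mul] at this
      exact (pos_of_mul_pos_right this hc.le).le
    · have hfG : ∀ g ∈ G₁ ∪ G₃, 0 ≤ f g := fun g hg =>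
        (hF g).1 (subset_hull (Finset.mem_coe.2 hg)) f hf
      have hW := hG₁' f (fun g hg => hfG g (Finset.mem_union_left _ hg)) (not_lt.1 hfu)
      have h1 := hG₂' (Set.mem_image_of_mem π hx)
      rw [Finset.coe_image] at h1
      obtain ⟨a, ha, hax⟩ : ∃ a ∈ hull ℝ (G₃ : Set V), π a = π x := by
        have h2 := Submodule.map_span (π.restrictScalars {c : ℝ // 0 ≤ c}) (G₃ : Set V)
        have h3 : π x ∈ Submodule.map (π.restrictScalars {c : ℝ // 0 ≤ c})
            (Submodule.span {c : ℝ // 0 ≤ c} (G₃ : Set V)) := by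
          rw [h2]; exact h1
        exact h3
      have h4 : f (x - a) = 0 := hW _ ((hπ _).1 (by rw [map_sub, hax, sub_self]))
      rw [map_sub, sub_eq_zero] at h4
      rw [h4]
      exact nonneg_of_mem_hull (f := (f : V →ₗ[ℝ] ℝ))
        (fun g hg => hfG g (Finset.mem_union_right _ hg)) ha

end LocalStep

-- Finite generation of cones of lattice points.

universe u

/-- The cone generated by the lattice points of an open convex neighbourhood of the origin is
finitely generated. -/
theorem exists_finset_generating_lattice_points (n : ℕ) :
    ∀ (V : Type u) [NormedAddCommGroup V] [NormedSpace ℝ V] [FiniteDimensional ℝ V],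
    Module.finrank ℝ V = n → ∀ (L : AddSubgroup V)
    (_ : ∀ R, ((L : Set V) ∩ Metric.closedBall 0 R).Finite)
    (R : ℝ) (_ : ∀ v, ∃ l ∈ L, ‖v - l‖ ≤ R)
    (D : Set V) (_ : Convex ℝ D) (_ : IsOpen D) (_ : (0 : V) ∈ D),
    ∃ G : Finset V, ↑G ⊆ D ∩ L ∧ D ∩ L ⊆ hull ℝ (G : Set V) := by
  classical
  induction n using Nat.strong_induction_on with
  | _ n ih =>
  intro V _ _ _ hn L hfin R hR D hconv hopen h0
  -- By compactness of the sphere it suffices to treat lattice points in directions close to a fixed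
  -- `u`.
  have hlocal : ∀ u ∈ Metric.sphere (0 : V) 1, ∃ G : Finset V, ↑G ⊆ D ∩ L ∧ ∃ U : Set V,
      IsOpen U ∧ u ∈ U ∧ ∀ x ∈ D ∩ L, ∀ c : ℝ, c = ‖x‖⁻¹ → 0 < c → c • x ∈ U →
        x ∈ hull ℝ (G : Set V) := by
    intro u hu1
    have hu0 : u ≠ 0 := by rintro rfl; simp at hu1
    by_cases hrec : ∀ t : ℝ, 0 < t → t • u ∈ closure D
    swap
    -- If the ray of `u` leaves the closure of `D`, points of `D` in nearby directions are bounded,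
    -- so finitely many lattice points occur.
    · push Not at hrec
      obtain ⟨t, ht, htu⟩ := hrec
      have hf : ((L : Set V) ∩ Metric.closedBall 0 t ∩ D).Finite := (hfin t).inter_of_left _
      refine ⟨hf.toFinset, fun x hx => ?_, {v | t • v ∉ closure D},
        isClosed_closure.isOpen_compl.preimage (continuous_const_smul t), htu, ?_⟩
      · have := hf.mem_toFinset.1 hx
        exact ⟨this.2, this.1.1⟩
      · rintro x ⟨hxD, hxL⟩ c rfl hc hxc
        refine subset_hull ?_
        rw [Finset.mem_coe, hf.mem_toFinset]
        refine ⟨⟨hxL, ?_⟩, hxD⟩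
        have := norm_lt_of_smul_notMem_closure hconv h0 hxD
          (by rintro rfl; simp at hc) ht hxc
        simpa using this.le
    -- `L` need not project discretely modulo the line of `u`. Dividing by `W`, the largest subspace
    -- in the closure of `L + ℝu`, leaves a closed group without lines, hence a discrete image of
    -- `L`.
    let H := lineClosure L u
    have hHc : IsClosed (H : Set V) := AddSubgroup.isClosed_topologicalClosure _
    let W := maxSubspace H
    have huW : u ∈ W := fun t => smul_mem_lineClosure L u t
    obtain ⟨W', hW'⟩ := Submodule.exists_isCompl W
    let π : V →ₗ[ℝ] W' := W'.projectionOnto W hW'.symm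
    have hπ : ∀ x, π x = 0 ↔ x ∈ W := fun x => Submodule.projectionOnto_apply_eq_zero_iff _
    have hπ' : ∀ x : W', π x = x := fun x => Submodule.projectionOnto_apply_left _ x
    have hπH : ∀ x ∈ H, (π x : V) ∈ H := fun x hx => by
      have : x - π x ∈ W := by rw [← hπ, map_sub, hπ', sub_self]
      have := H.sub_mem hx (mem_of_mem_maxSubspace this)
      simpa using this
    let H' : AddSubgroup W' := H.comap W'.subtype.toAddMonoidHom
    have hH'c : IsClosed (H' : Set W') := hHc.preimage continuous_subtype_val
    have hH'line : ∀ w : W', (∀ t : ℝ, t • w ∈ H') → w = 0 := fun w hw => by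
      have h1 : (w : V) ∈ W := fun t => hw t
      rw [← hπ' w, (hπ _).2 h1]
    have hLH' : L.map π.toAddMonoidHom ≤ H' := by
      rintro _ ⟨l, hl, rfl⟩
      exact hπH l (le_lineClosure L u hl)
    let πc : V →L[ℝ] W' := LinearMap.toContinuousLinearMap π
    obtain ⟨δ, hδ, hδ0⟩ := exists_pos_forall_norm_lt_eq_zero H' hH'c hH'line
    -- A lattice point very near `W` has a projection below the discreteness threshold `δ`, so it
    -- lies in `W`.
    have hsmall : ∃ ε₀ > 0, ∀ l ∈ L, ∀ w ∈ W, ∀ t : ℝ, ‖l - t • u - w‖ < ε₀ → l ∈ W := by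
      refine ⟨δ / (‖πc‖ + 1), by positivity, fun l hl w hw t h => ?_⟩
      rw [← hπ]
      have h1 : π l = πc (l - t • u - w) := by
        change π l = π (l - t • u - w)
        rw [map_sub, map_sub, map_smul, (hπ u).2 huW, (hπ w).2 hw]
        simp
      refine hδ0 _ (hLH' ⟨l, hl, rfl⟩) ?_
      rw [h1]
      refine (πc.le_opNorm _).trans_lt ?_
      rw [lt_div_iff₀ (by positivity)] at h
      nlinarith [norm_nonneg (l - t • u - w)]
    obtain ⟨ε₀, hε₀, hsm⟩ := hsmall
    have happrox : ∀ w ∈ W, ∀ ε > 0, ∃ l ∈ L, l ∈ W ∧ ∃ t : ℝ, 0 ≤ t ∧ ‖l - t • u - w‖ < ε := by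
      intro w hw ε hε
      obtain ⟨l, hl, t, ht, h⟩ := exists_near_nonneg_of_mem_lineClosure hR
        (mem_of_mem_maxSubspace hw) (lt_min hε hε₀)
      exact ⟨l, hl, hsm l hl w hw t (h.trans_le (min_le_right _ _)), t, ht,
        h.trans_le (min_le_left _ _)⟩
    have hnear : ∀ d ∈ D, ∃ ε > 0, ∀ (x : V) (t : ℝ), 0 ≤ t → ‖x - t • u - d‖ < ε → x ∈ D := by
      intro d hd
      obtain ⟨ε, hε, hball⟩ := Metric.isOpen_iff.1 hopen d hd
      refine ⟨ε, hε, fun x t ht hx => ?_⟩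
      have h1 : x - t • u ∈ D := hball (by rwa [Metric.mem_ball, dist_eq_norm])
      have := add_smul_mem_of_recession hconv hopen hrec h1 ht
      simpa using this
    -- When a point of `D` and one of `L` have equal projections, their difference in `W` is
    -- approximated by a lattice point of `W` up to a forward move along `u`. Hence the projected
    -- problem has the same form, in lower dimension since `u` lies in `W`.
    have himage : π '' (D ∩ L) = (π '' D) ∩ (L.map π.toAddMonoidHom : Set W') := by
      ext y
      constructor
      · rintro ⟨x, ⟨hxD, hxL⟩, rfl⟩
        exact ⟨⟨x, hxD, rfl⟩, ⟨x, hxL, rfl⟩⟩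
      · rintro ⟨⟨d, hd, rfl⟩, ⟨l, hl, hld⟩⟩
        have hld : π l = π d := hld
        have hw : d - l ∈ W := by rw [← hπ, map_sub, hld, sub_self]
        obtain ⟨ε, hε, hD⟩ := hnear d hd
        obtain ⟨l', hl', hl'W, t, ht, h⟩ := happrox _ hw ε hε
        refine ⟨l + l', ⟨hD _ t ht ?_, L.add_mem hl hl'⟩, ?_⟩
        · convert h using 2
          abel
        · rw [map_add, (hπ l').2 hl'W, add_zero, hld]
    have hlt : Module.finrank ℝ W' < n := by
      have h1 := Submodule.finrank_add_eq_of_isCompl hW'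
      have h2 : 0 < Module.finrank ℝ W := by
        have : Nontrivial W := ⟨⟨⟨u, huW⟩, 0, fun h => hu0 (congrArg Subtype.val h)⟩⟩
        exact Module.finrank_pos
      omega
    have hquot : ∃ G : Finset W', ↑G ⊆ π '' (D ∩ L) ∧ π '' (D ∩ L) ⊆ hull ℝ (G : Set W') := by
      rw [himage]
      refine ih _ hlt W' rfl (L.map π.toAddMonoidHom) (fun r => ?_) (‖πc‖ * R) (fun v => ?_)
        (π '' D) (hconv.linear_image π) ?_ ⟨0, h0, map_zero π⟩
      · exact (finite_inter_closedBall_of_no_line H' hH'c hH'line r).subset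
          (Set.inter_subset_inter_left _ hLH')
      · obtain ⟨l, hl, hlR⟩ := hR v
        refine ⟨π l, ⟨l, hl, rfl⟩, ?_⟩
        have h1 : v - π l = πc (v - l) := by
          change v - π l = π (v - l)
          rw [map_sub, hπ']
        rw [h1]
        exact (πc.le_opNorm _).trans (mul_le_mul_of_nonneg_left hlR (norm_nonneg _))
      · have hsurj : Function.Surjective πc := fun y => ⟨y, hπ' y⟩
        exact πc.isOpenMap hsurj D hopen
    -- Half of `r` is spent on `w` and half on the approximation error.
    obtain ⟨r, hr, hDr⟩ := hnear 0 h0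
    obtain ⟨G, hG, U, hU, huU, h⟩ := exists_local_generators W (D ∩ L) u huW π hπ (half_pos hr)
      (fun w hw hwr ε hε => by
        obtain ⟨l, hl, hlW, t, ht, h⟩ := happrox w hw (min ε (r / 2)) (lt_min hε (half_pos hr))
        refine ⟨l, ⟨hDr l t ht ?_, hl⟩, hlW, t, ht, h.trans_le (min_le_left _ _)⟩
        have h1 : l - t • u - 0 = (l - t • u - w) + w := by abel
        rw [h1]
        have := h.trans_le (min_le_right _ _)
        exact (norm_add_le _ _).trans_lt (by linarith)) hquot
    exact ⟨G, hG, U, hU, huU, fun x hx c _ hc hcx => h x hx c hc hcx⟩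
  choose! G hG U hU huU hgen using hlocal
  obtain ⟨t, htsub, ht⟩ := (isCompact_sphere (0 : V) 1).elim_nhds_subcover U
    (fun u hu => (hU u hu).mem_nhds (huU u hu))
  refine ⟨t.biUnion G, ?_, fun x hx => ?_⟩
  · intro x hx
    obtain ⟨u, hu, hxu⟩ := Finset.mem_biUnion.1 (Finset.mem_coe.1 hx)
    exact hG u (htsub u hu) hxu
  · rcases eq_or_ne x 0 with rfl | hx0
    · exact zero_mem _
    have hpos : 0 < ‖x‖⁻¹ := inv_pos.2 (norm_pos_iff.2 hx0)
    have hmem : ‖x‖⁻¹ • x ∈ Metric.sphere (0 : V) 1 := by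
      simp [norm_smul, inv_mul_cancel₀ (norm_ne_zero_iff.2 hx0)]
    obtain ⟨u, hu, hxu⟩ := Set.mem_iUnion₂.1 (ht hmem)
    exact Submodule.span_mono (by
      intro y hy
      exact Finset.mem_coe.2 (Finset.mem_biUnion.2 ⟨u, hu, hy⟩))
      (hgen u (htsub u hu) x hx _ rfl hpos hxu)

/-! ### Rational structures and lattices in coordinates. -/

section Rational

variable {V : Type*} [NormedAddCommGroup V] [NormedSpace ℝ V]

/-- The subfield of rational numbers inside the reals. -/
noncomputable def ratSubfield : Subfield ℝ := (Rat.castHom ℝ).fieldRange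

theorem mem_ratSubfield {x : ℝ} : x ∈ ratSubfield ↔ ∃ q : ℚ, x = q := by
  simp [ratSubfield, RingHom.mem_fieldRange, eq_comm]

variable [Module ℚ V]

theorem smul_mem_of_mem_ratSubfield (VQ : Submodule ℚ V) {a : ℝ} (ha : a ∈ ratSubfield) {x : V}
    (hx : x ∈ VQ) : a • x ∈ VQ := by
  obtain ⟨q, rfl⟩ := mem_ratSubfield.1 ha
  rw [Rat.cast_smul_eq_qsmul]
  exact VQ.smul_mem q hx

theorem combo_mem_of_mem_ratSubfield (VQ : Submodule ℚ V) : ∀ y ∈ VQ, ∀ z ∈ VQ,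
    ∀ a ∈ ratSubfield, ∀ b ∈ ratSubfield, a • y + b • z ∈ VQ := fun _ hy _ hz _ ha _ hb =>
  VQ.add_mem (smul_mem_of_mem_ratSubfield VQ ha hy) (smul_mem_of_mem_ratSubfield VQ hb hz)

theorem natCast_smul_mem (VQ : Submodule ℚ V) (n : ℕ) {x : V} (hx : x ∈ VQ) :
    (n : ℝ) • x ∈ VQ :=
  smul_mem_of_mem_ratSubfield VQ (mem_ratSubfield.2 ⟨n, by simp⟩) hx

omit [Module ℚ V] in
theorem natCast_smul_mem_int (L : Submodule ℤ V) (n : ℕ) {x : V} (hx : x ∈ L) :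
    (n : ℝ) • x ∈ L := by
  rw [Nat.cast_smul_eq_nsmul]
  exact L.nsmul_mem hx n

variable {ι : Type*}

theorem mem_span_rat_iff (b : Module.Basis ι ℝ V) (x : V) :
    x ∈ Submodule.span ℚ (Set.range b) ↔ ∀ i, ∃ q : ℚ, b.repr x i = q := by
  rw [b.mem_span_iff_repr_mem ℚ]
  simp [eq_comm]

omit [Module ℚ V] in
theorem mem_span_int_iff (b : Module.Basis ι ℝ V) (x : V) :
    x ∈ Submodule.span ℤ (Set.range b) ↔ ∀ i, ∃ n : ℤ, b.repr x i = n := by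
  rw [b.mem_span_iff_repr_mem ℤ]
  simp [eq_comm]

theorem span_int_subset_span_rat (b : Module.Basis ι ℝ V) :
    (Submodule.span ℤ (Set.range b) : Set V) ⊆ Submodule.span ℚ (Set.range b) := by
  intro x hx
  rw [SetLike.mem_coe, mem_span_int_iff] at hx
  rw [SetLike.mem_coe, mem_span_rat_iff]
  intro i
  obtain ⟨n, hn⟩ := hx i
  exact ⟨n, by simp [hn]⟩

theorem exists_nat_smul_mem_span_int [Fintype ι] (b : Module.Basis ι ℝ V) {x : V}
    (hx : x ∈ Submodule.span ℚ (Set.range b)) :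
    ∃ n : ℕ, 0 < n ∧ (n : ℝ) • x ∈ Submodule.span ℤ (Set.range b) := by
  rw [mem_span_rat_iff] at hx
  choose q hq using hx
  refine ⟨∏ i, (q i).den, Finset.prod_pos fun i _ => (q i).den_pos, ?_⟩
  rw [mem_span_int_iff]
  intro i
  obtain ⟨k, hk⟩ := Finset.dvd_prod_of_mem (fun i => (q i).den) (Finset.mem_univ i)
  refine ⟨k * (q i).num, ?_⟩
  have hk' : ((∏ i, (q i).den : ℕ) : ℝ) = (q i).den * k := by rw [hk]; push_cast; rfl
  rw [map_smul, Finsupp.smul_apply, hq, hk', smul_eq_mul]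
  have hd : ((q i).den : ℝ) ≠ 0 := by exact_mod_cast (q i).den_nz
  have h2 : ((q i : ℚ) : ℝ) = (q i).num / (q i).den := Rat.cast_def _
  rw [h2]
  push_cast
  field_simp

/-- A rational structure and a lattice in it have a common basis. -/
theorem IsLatticeIn.exists_common_basis [FiniteDimensional ℝ V] {VQ : Submodule ℚ V}
    {L : Submodule ℤ V} (hVQ : IsRationalStructure VQ) (hL : IsLatticeIn VQ L) :
    ∃ b : Module.Basis (Fin (Module.finrank ℝ V)) ℝ V,
      VQ = Submodule.span ℚ (Set.range b) ∧ L = Submodule.span ℤ (Set.range b) := by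
  obtain ⟨c, hc⟩ := hVQ
  obtain ⟨b, hb, hbL⟩ := hL
  refine ⟨b, ?_, hbL⟩
  have hfin : Module.Finite ℚ VQ := by
    rw [hc]
    exact Module.Finite.span_of_finite ℚ (Set.finite_range c)
  have hle : Submodule.span ℚ (Set.range b) ≤ VQ := by
    rw [Submodule.span_le]
    rintro _ ⟨i, rfl⟩
    exact hb i
  refine (Submodule.eq_of_le_of_finrank_eq hle ?_).symm
  have hind : ∀ d : Module.Basis (Fin (Module.finrank ℝ V)) ℝ V, LinearIndependent ℚ d :=
    fun d => d.linearIndependent.restrict_scalars (by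
      intro p q hpq
      simpa [Rat.smul_def] using hpq)
  rw [hc, finrank_span_eq_card (hind b), finrank_span_eq_card (hind c)]

omit [Module ℚ V] in
theorem span_int_finite_inter [FiniteDimensional ℝ V] [Finite ι] (b : Module.Basis ι ℝ V)
    {s : Set V} (hs : Bornology.IsBounded s) :
    ((Submodule.span ℤ (Set.range b) : Set V) ∩ s).Finite := by
  have : ProperSpace V := FiniteDimensional.proper ℝ V
  rw [Set.inter_comm]
  exact ZSpan.setFinite_inter b hs

omit [Module ℚ V] in
theorem span_int_cocompact [Fintype ι] (b : Module.Basis ι ℝ V) (v : V) :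
    ∃ l ∈ Submodule.span ℤ (Set.range b), ‖v - l‖ ≤ ∑ i, ‖b i‖ := by
  refine ⟨ZSpan.floor b v, (ZSpan.floor b v).2, ?_⟩
  exact ZSpan.norm_fract_le b v

/-- Points of an open set are convex combinations of rational points of that set. -/
theorem mem_convexHull_inter_span_rat [Fintype ι] (b : Module.Basis ι ℝ V) {U : Set V}
    (hU : IsOpen U) {x : V} (hx : x ∈ U) :
    x ∈ convexHull ℝ (U ∩ (Submodule.span ℚ (Set.range b) : Set V)) := by
  have hfd : FiniteDimensional ℝ V := b.finiteDimensional_of_finite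
  let e := b.equivFunL
  have hopen : IsOpen (e.symm ⁻¹' U) := hU.preimage e.symm.continuous
  obtain ⟨ε, hε, hball⟩ := Metric.isOpen_iff.1 hopen (e x) (by simpa using hx)
  choose p hp using fun i => exists_rat_btwn (show e x i - ε < e x i by linarith)
  choose q hq using fun i => exists_rat_btwn (show e x i < e x i + ε by linarith)
  -- The vertices of a small box with rational corners around the point.
  let B : Set (ι → ℝ) := Set.univ.pi fun i => {(p i : ℝ), (q i : ℝ)}
  have hB : e x ∈ convexHull ℝ B := by
    rw [convexHull_pi]
    intro i _
    change e x i ∈ convexHull ℝ {(p i : ℝ), (q i : ℝ)}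
    rw [convexHull_pair, segment_eq_Icc ((hp i).2.le.trans (hq i).1.le)]
    exact ⟨(hp i).2.le, (hq i).1.le⟩
  have himg : e.symm '' B ⊆ U ∩ (Submodule.span ℚ (Set.range b) : Set V) := by
    rintro _ ⟨y, hy, rfl⟩
    have hy' : ∀ i, y i = p i ∨ y i = q i := fun i => by simpa using hy i trivial
    constructor
    · apply hball
      rw [Metric.mem_ball, dist_pi_lt_iff hε]
      intro i
      rw [Real.dist_eq, abs_lt]
      rcases hy' i with h | h <;> rw [h]
      · constructor <;> linarith [(hp i).1, (hp i).2]
      · constructor <;> linarith [(hq i).1, (hq i).2]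
    · rw [SetLike.mem_coe, mem_span_rat_iff]
      intro i
      have h1 : b.repr (e.symm y) i = y i := by
        change e (e.symm y) i = y i
        rw [e.apply_symm_apply]
      rw [h1]
      rcases hy' i with h | h
      exacts [⟨_, h⟩, ⟨_, h⟩]
  have h2 : e.symm (e x) ∈ e.symm '' convexHull ℝ B := ⟨_, hB, rfl⟩
  rw [e.symm_apply_apply] at h2
  have h3 := (e.symm : (ι → ℝ) →ₗ[ℝ] V).image_convexHull B
  have h4 : x ∈ convexHull ℝ (e.symm '' B) := by
    rw [← show (e.symm : (ι → ℝ) →ₗ[ℝ] V) '' B = e.symm '' B from rfl, ← h3]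
    exact h2
  exact convexHull_mono himg h4

end Rational

/-! ### Dual lattice and dual rational structure. -/

section DualLattice

variable {V : Type*} [NormedAddCommGroup V] [NormedSpace ℝ V] [FiniteDimensional ℝ V]

/-- The forms that take integral values on `L`. -/
def dualLattice (L : Submodule ℤ V) : Submodule ℤ (StrongDual ℝ V) where
  carrier := {ξ | ∀ v ∈ L, ∃ n : ℤ, ξ v = n}
  zero_mem' := fun _ _ => ⟨0, by simp⟩
  add_mem' := fun {ξ η} hξ hη v hv => by
    obtain ⟨p, hp⟩ := hξ v hv
    obtain ⟨q, hq⟩ := hη v hv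
    exact ⟨p + q, by simp [hp, hq]⟩
  smul_mem' := fun c ξ hξ v hv => by
    obtain ⟨p, hp⟩ := hξ v hv
    exact ⟨c * p, by simp [hp]⟩

omit [FiniteDimensional ℝ V] in
theorem mem_dualLattice {L : Submodule ℤ V} {ξ : StrongDual ℝ V} :
    ξ ∈ dualLattice L ↔ ∀ v ∈ L, ∃ n : ℤ, ξ v = n := Iff.rfl

omit [FiniteDimensional ℝ V] in
theorem mem_dualRational [Module ℚ V] {VQ : Submodule ℚ V} {ξ : StrongDual ℝ V} :
    ξ ∈ dualRational VQ ↔ ∀ v ∈ VQ, ∃ q : ℚ, ξ v = q := Iff.rfl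

variable {ι : Type*} [Fintype ι]

/-- The basis of the continuous dual that is dual to a given basis. -/
noncomputable def strongDualBasis (b : Module.Basis ι ℝ V) :
    Module.Basis ι ℝ (StrongDual ℝ V) := by
  classical exact b.dualBasis.map LinearMap.toContinuousLinearMap

@[simp] theorem strongDualBasis_apply (b : Module.Basis ι ℝ V) (i : ι) :
    strongDualBasis b i = coordL b i := by
  classical
  ext v
  simp [strongDualBasis]

@[simp] theorem strongDualBasis_repr (b : Module.Basis ι ℝ V) (ξ : StrongDual ℝ V) (i : ι) :
    (strongDualBasis b).repr ξ i = ξ (b i) := by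
  classical
  simp [strongDualBasis]

omit [FiniteDimensional ℝ V] in
theorem apply_eq_sum (b : Module.Basis ι ℝ V) (ξ : StrongDual ℝ V) (v : V) :
    ξ v = ∑ i, b.repr v i * ξ (b i) := by
  conv_lhs => rw [← b.sum_repr v, map_sum]
  simp

theorem dualRational_span_rat [Module ℚ V] (b : Module.Basis ι ℝ V) :
    dualRational (Submodule.span ℚ (Set.range b)) =
      Submodule.span ℚ (Set.range (strongDualBasis b)) := by
  ext ξ
  rw [mem_span_rat_iff, mem_dualRational]
  simp only [strongDualBasis_repr]
  constructor
  · intro h i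
    exact h _ (Submodule.subset_span ⟨i, rfl⟩)
  · intro h v hv
    rw [mem_span_rat_iff] at hv
    choose p hp using h
    choose q hq using hv
    exact ⟨∑ i, q i * p i, by rw [apply_eq_sum b]; simp [hp, hq]⟩

theorem dualLattice_span_int (b : Module.Basis ι ℝ V) :
    dualLattice (Submodule.span ℤ (Set.range b)) =
      Submodule.span ℤ (Set.range (strongDualBasis b)) := by
  ext ξ
  rw [mem_span_int_iff, mem_dualLattice]
  simp only [strongDualBasis_repr]
  constructor
  · intro h i
    exact h _ (Submodule.subset_span ⟨i, rfl⟩)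
  · intro h v hv
    rw [mem_span_int_iff] at hv
    choose p hp using h
    choose q hq using hv
    exact ⟨∑ i, q i * p i, by rw [apply_eq_sum b]; simp [hp, hq]⟩

theorem finrank_strongDual : Module.finrank ℝ (StrongDual ℝ V) = Module.finrank ℝ V := by
  rw [Module.finrank_eq_card_basis (strongDualBasis (Module.finBasis ℝ V)), Fintype.card_fin]

theorem exists_dual_common_basis [Module ℚ V]
    (b : Module.Basis (Fin (Module.finrank ℝ V)) ℝ V) :
    ∃ β : Module.Basis (Fin (Module.finrank ℝ (StrongDual ℝ V))) ℝ (StrongDual ℝ V),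
      dualRational (Submodule.span ℚ (Set.range b)) = Submodule.span ℚ (Set.range β) ∧
      dualLattice (Submodule.span ℤ (Set.range b)) = Submodule.span ℤ (Set.range β) := by
  refine ⟨(strongDualBasis b).reindex (finCongr finrank_strongDual.symm), ?_, ?_⟩
  · rw [dualRational_span_rat, Module.Basis.range_reindex]
  · rw [dualLattice_span_int, Module.Basis.range_reindex]

omit [Fintype ι] in
/-- Any point at which all rational forms take rational values is rational. -/
theorem mem_span_rat_of_dual [Module ℚ V] (b : Module.Basis ι ℝ V) {x : V}
    (hx : ∀ ξ ∈ dualRational (Submodule.span ℚ (Set.range b)), ∃ q : ℚ, ξ x = q) :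
    x ∈ Submodule.span ℚ (Set.range b) := by
  rw [mem_span_rat_iff]
  intro i
  refine hx (coordL b i) fun v hv => ?_
  exact (mem_span_rat_iff b v).1 hv i

/-- The dual of a finite set of rational points is generated by finitely many rational forms. -/
theorem exists_finset_rational_forms [Module ℚ V] (b : Module.Basis ι ℝ V) (G : Finset V)
    (hG : (G : Set V) ⊆ Submodule.span ℚ (Set.range b)) :
    ∃ H : Finset (StrongDual ℝ V), (H : Set (StrongDual ℝ V)) ⊆
      dualRational (Submodule.span ℚ (Set.range b)) ∧
      ∀ ξ : StrongDual ℝ V, (∀ g ∈ G, 0 ≤ ξ g) ↔ ξ ∈ hull ℝ (H : Set (StrongDual ℝ V)) := by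
  have hb : ∀ i, b i ∈ Submodule.span ℚ (Set.range b) := fun i => Submodule.subset_span ⟨i, rfl⟩
  have hβ : ∀ i, coordL b i ∈ dualRational (Submodule.span ℚ (Set.range b)) := fun i v hv =>
    (mem_span_rat_iff b v).1 hv i
  -- Here the control on the field of definition is needed: over `ratSubfield` the generators come
  -- out rational.
  exact exists_finset_forall_nonneg_iff (evalPairing V).flip ratSubfield
    (dualRational (Submodule.span ℚ (Set.range b))) (Submodule.span ℚ (Set.range b))
    (fun ξ hξ v hv => mem_ratSubfield.2 (hξ v hv))
    (combo_mem_of_mem_ratSubfield _) (combo_mem_of_mem_ratSubfield _)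
    (exists_finset_forms_eq_zero b _ hβ fun i => Submodule.neg_mem _ (hβ i))
    (exists_finset_points_eq_zero b _ hb fun i => Submodule.neg_mem _ (hb i)) G hG

end DualLattice

/-! ### Duality of open convex cones. -/

section ConeBasics

variable {V : Type*} [NormedAddCommGroup V] [NormedSpace ℝ V] {C : Set V}

/-- The closed dual cone of a set. -/
def closedDual (C : Set V) : Set (StrongDual ℝ V) := {ξ | ∀ x ∈ C, 0 ≤ ξ x}

theorem openDual_subset_closedDual : openDual C ⊆ closedDual C := interior_subset

theorem closedDual_nonneg_closure {ξ : StrongDual ℝ V} (hξ : ξ ∈ closedDual C) {x : V}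
    (hx : x ∈ closure C) : 0 ≤ ξ x :=
  closure_minimal (show C ⊆ {x | 0 ≤ ξ x} from hξ)
    (isClosed_le continuous_const ξ.continuous) hx

theorem convex_closedDual : Convex ℝ (closedDual C) := by
  intro ξ hξ η hη a b ha hb _ x hx
  exact add_nonneg (mul_nonneg ha (hξ x hx)) (mul_nonneg hb (hη x hx))

theorem isClosed_closedDual : IsClosed (closedDual C) := by
  have : closedDual C = ⋂ x ∈ C, {ξ : StrongDual ℝ V | 0 ≤ ξ x} := by
    ext ξ; simp [closedDual]
  rw [this]
  exact isClosed_biInter fun x _ =>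
    isClosed_le continuous_const (ContinuousLinearMap.apply ℝ ℝ x).continuous

theorem smul_mem_closedDual {ξ : StrongDual ℝ V} (hξ : ξ ∈ closedDual C) {c : ℝ} (hc : 0 ≤ c) :
    c • ξ ∈ closedDual C := fun x hx => mul_nonneg hc (hξ x hx)

theorem exists_eval_eq [FiniteDimensional ℝ V] (f : StrongDual ℝ (StrongDual ℝ V)) :
    ∃ x : V, ∀ ξ : StrongDual ℝ V, f ξ = ξ x := by
  let b := Module.finBasis ℝ V
  refine ⟨∑ i, f (coordL b i) • b i, fun ξ => ?_⟩
  rw [apply_eq_sum (strongDualBasis b) f ξ, map_sum]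
  refine Finset.sum_congr rfl fun i _ => ?_
  simp [mul_comm]

/-- Scaling by `N` enlarges a ball in `C` to radius `R + 1`, beyond the covering radius bound `R` of
the lattice. -/
theorem IsCone.exists_lattice_point {ι : Type*} [Fintype ι] (hC : IsCone C) (hopen : IsOpen C)
    (b : Module.Basis ι ℝ V) :
    ∃ l ∈ Submodule.span ℤ (Set.range b), l ∈ C := by
  obtain ⟨x, hx⟩ := hC.1
  obtain ⟨r, hr, hball⟩ := Metric.isOpen_iff.1 hopen x hx
  let R := ∑ i, ‖b i‖
  have hR : 0 ≤ R := Finset.sum_nonneg fun i _ => norm_nonneg _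
  let N : ℝ := (R + 1) / r
  have hN : 0 < N := by positivity
  obtain ⟨l, hl, hlR⟩ := span_int_cocompact b (N • x)
  refine ⟨l, hl, ?_⟩
  have h1 : N⁻¹ • l ∈ C := by
    apply hball
    rw [mem_ball_iff_norm, ← norm_neg]
    have : -(N⁻¹ • l - x) = N⁻¹ • (N • x - l) := by
      rw [smul_sub, smul_smul, inv_mul_cancel₀ hN.ne', one_smul]; abel
    rw [this, norm_smul, Real.norm_of_nonneg (by positivity), inv_mul_lt_iff₀ hN]
    have : N * r = R + 1 := by simp only [N]; field_simp
    rw [this]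
    change ‖N • x - l‖ < R + 1
    linarith
  have := hC.2 N hN _ h1
  rwa [smul_smul, mul_inv_cancel₀ hN.ne', one_smul] at this

/-- The values of a form in the open dual cone control the norm on `C`. -/
theorem exists_norm_le_form {ξ : StrongDual ℝ V} (hξ : ξ ∈ openDual C) :
    ∃ r > 0, ∀ x ∈ closure C, r * ‖x‖ ≤ ξ x := by
  obtain ⟨r, hr, hball⟩ := Metric.isOpen_iff.1 isOpen_interior ξ hξ
  refine ⟨r / 2, half_pos hr, fun x hx => ?_⟩
  obtain ⟨g, hg1, hgx⟩ := exists_dual_vector'' ℝ x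
  have h1 : ξ - (r / 2) • g ∈ closedDual C := by
    apply openDual_subset_closedDual
    apply hball
    rw [mem_ball_iff_norm, sub_sub_cancel_left, norm_neg, norm_smul,
      Real.norm_of_nonneg (by positivity)]
    nlinarith
  have h2 : 0 ≤ ξ x - r / 2 * g x := closedDual_nonneg_closure h1 hx
  have h3 : g x = ‖x‖ := by simpa using hgx
  rw [h3] at h2
  linarith

namespace IsOpenNondegenerateConvexCone

variable (hC : IsOpenNondegenerateConvexCone C)

include hC

theorem smul_mem {c : ℝ} (hc : 0 < c) {x : V} (hx : x ∈ C) : c • x ∈ C := hC.isCone.2 c hc x hx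

theorem add_mem_of_closure {x y : V} (hx : x ∈ C) (hy : y ∈ closure C) : x + y ∈ C := by
  have h := hC.convex.combo_interior_closure_mem_interior (x := x) (y := y)
    (by rwa [hC.isOpen.interior_eq]) hy (a := 1 / 2) (b := 1 / 2) (by norm_num) (by norm_num)
    (by norm_num)
  rw [hC.isOpen.interior_eq] at h
  have := hC.smul_mem (c := 2) (by norm_num) h
  rwa [smul_add, smul_smul, smul_smul, show (2 : ℝ) * (1 / 2) = 1 by norm_num, one_smul,
    one_smul] at this

theorem smul_mem_closure {c : ℝ} (hc : 0 < c) {x : V} (hx : x ∈ closure C) : c • x ∈ closure C :=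
  map_mem_closure (continuous_const_smul c) hx fun _ h => hC.smul_mem hc h

theorem zero_mem_closure : (0 : V) ∈ closure C := by
  obtain ⟨x, hx⟩ := hC.isCone.1
  have h1 : Tendsto (fun n : ℕ => (1 / ((n : ℝ) + 1)) • x) atTop (𝓝 ((0 : ℝ) • x)) :=
    tendsto_one_div_add_atTop_nhds_zero_nat.smul_const x
  rw [zero_smul] at h1
  exact mem_closure_of_tendsto h1
    (Eventually.of_forall fun n => hC.smul_mem (by positivity) hx)

theorem smul_mem_closure_of_nonneg {c : ℝ} (hc : 0 ≤ c) {x : V} (hx : x ∈ closure C) :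
    c • x ∈ closure C := by
  rcases hc.eq_or_lt with rfl | hc
  · rw [zero_smul]; exact hC.zero_mem_closure
  · exact hC.smul_mem_closure hc hx

theorem add_mem_closure {x y : V} (hx : x ∈ closure C) (hy : y ∈ closure C) :
    x + y ∈ closure C := by
  have h := hC.convex.closure hx hy (a := 1 / 2) (b := 1 / 2) (by norm_num) (by norm_num)
    (by norm_num)
  have := hC.smul_mem_closure (c := 2) (by norm_num) h
  rwa [smul_add, smul_smul, smul_smul, show (2 : ℝ) * (1 / 2) = 1 by norm_num, one_smul,
    one_smul] at this

/-- The bipolar theorem. -/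
theorem mem_closure_of_forall_closedDual {x : V} (hx : ∀ ξ ∈ closedDual C, 0 ≤ ξ x) :
    x ∈ closure C := by
  by_contra hxC
  obtain ⟨f, u, hfx, hf⟩ := geometric_hahn_banach_point_closed hC.convex.closure isClosed_closure
    hxC
  have hu : u < 0 := by simpa using hf 0 hC.zero_mem_closure
  have hfC : f ∈ closedDual C := by
    intro y hy
    by_contra! hneg
    have h1 := hf _ (subset_closure (hC.smul_mem (c := u / f y)
      (div_pos_of_neg_of_neg hu hneg) hy))
    rw [map_smul, smul_eq_mul, div_mul_cancel₀ _ hneg.ne] at h1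
    exact lt_irrefl _ h1
  linarith [hx f hfC]

theorem eq_zero_of_mem_closure_neg {v : V} (h1 : v ∈ closure C) (h2 : -v ∈ closure C) :
    v = 0 := by
  by_contra hv
  obtain ⟨x, hx⟩ := hC.isCone.1
  refine hC.nondegenerate ⟨x, v, hv, fun t => hC.add_mem_of_closure hx ?_⟩
  rcases le_total 0 t with ht | ht
  · exact hC.smul_mem_closure_of_nonneg ht h1
  · have := hC.smul_mem_closure_of_nonneg (neg_nonneg.2 ht) h2
    rwa [neg_smul_neg] at this

/-- The values of nonnegative forms at a point of `C` control their norms. -/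
theorem exists_norm_form_le {x : V} (hx : x ∈ C) :
    ∃ r > 0, ∀ ξ ∈ closedDual C, r * ‖ξ‖ ≤ ξ x := by
  obtain ⟨r, hr, hball⟩ := Metric.isOpen_iff.1 hC.isOpen x hx
  refine ⟨r / 2, half_pos hr, fun ξ hξ => ?_⟩
  rw [← le_div_iff₀' (half_pos hr)]
  have key : ∀ v : V, ξ v ≤ ξ x / (r / 2) * ‖v‖ := by
    intro v
    rcases eq_or_ne v 0 with rfl | hv
    · simp
    have hvn : 0 < ‖v‖ := norm_pos_iff.2 hv
    have h1 : x - (r / 2 / ‖v‖) • v ∈ C := by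
      apply hball
      rw [mem_ball_iff_norm, sub_sub_cancel_left, norm_neg, norm_smul,
        Real.norm_of_nonneg (by positivity), div_mul_cancel₀ _ hvn.ne']
      linarith
    have h2 := hξ _ h1
    rw [map_sub, map_smul, smul_eq_mul] at h2
    have h3 : r / 2 / ‖v‖ * ξ v ≤ ξ x := by linarith
    rw [div_mul_eq_mul_div, div_le_iff₀ hvn] at h3
    rw [div_mul_eq_mul_div, le_div_iff₀ (half_pos hr)]
    linarith
  refine ContinuousLinearMap.opNorm_le_bound _ (div_nonneg (hξ x hx) (half_pos hr).le)
    fun v => ?_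
  rw [Real.norm_eq_abs, abs_le]
  constructor
  · have := key (-v)
    rw [map_neg, norm_neg] at this
    linarith
  · exact key v

/-- Evaluation at a point of `C` lies in the open bidual cone. -/
theorem eval_mem_openDual_openDual {x : V} (hx : x ∈ C) :
    NormedSpace.inclusionInDoubleDual ℝ V x ∈ openDual (openDual C) := by
  obtain ⟨r, hr, h⟩ := hC.exists_norm_form_le hx
  refine interior_maximal (fun f hf ξ hξ => ?_) Metric.isOpen_ball
    (Metric.mem_ball_self (x := NormedSpace.inclusionInDoubleDual ℝ V x) hr)
  rw [mem_ball_iff_norm] at hf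
  have h1 := h ξ (openDual_subset_closedDual hξ)
  have h2 := (f - NormedSpace.inclusionInDoubleDual ℝ V x).le_opNorm ξ
  have h3 := (abs_le.1 (Real.norm_eq_abs _ ▸ h2)).1
  have h4 : (f - NormedSpace.inclusionInDoubleDual ℝ V x) ξ = f ξ - ξ x := rfl
  rw [h4] at h3
  have h5 : ‖f - NormedSpace.inclusionInDoubleDual ℝ V x‖ * ‖ξ‖ ≤ r * ‖ξ‖ :=
    mul_le_mul_of_nonneg_right hf.le (norm_nonneg _)
  linarith

variable [FiniteDimensional ℝ V]

/-- Nondegeneracy enters here: if the dual cone did not span, some `x ≠ 0` would be killed by all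
its forms, and by the bipolar theorem `x` and `-x` would both lie in the closure of `C`. -/
theorem openDual_nonempty : (openDual C).Nonempty := by
  have hconv : Convex ℝ (closedDual C) := convex_closedDual
  refine hconv.interior_nonempty_iff_affineSpan_eq_top.2 ?_
  have h0 : (0 : StrongDual ℝ V) ∈ closedDual C := fun x _ => le_rfl
  have hspan : Submodule.span ℝ (closedDual C) = ⊤ := by
    by_contra hne
    obtain ⟨f, hf0, hf⟩ := Submodule.exists_le_ker_of_lt_top _ (lt_top_iff_ne_top.2 hne)
    obtain ⟨x, hx⟩ := exists_eval_eq (LinearMap.toContinuousLinearMap f)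
    have hz : ∀ ξ ∈ closedDual C, ξ x = 0 := fun ξ hξ => by
      rw [← hx]
      exact hf (Submodule.subset_span hξ)
    have hx0 : x = 0 := hC.eq_zero_of_mem_closure_neg
      (hC.mem_closure_of_forall_closedDual fun ξ hξ => (hz ξ hξ).ge)
      (hC.mem_closure_of_forall_closedDual fun ξ hξ => by rw [map_neg, hz ξ hξ, neg_zero])
    refine hf0 (LinearMap.ext fun ξ => ?_)
    have := hx ξ
    rw [hx0, map_zero] at this
    exact this
  rw [AffineSubspace.affineSpan_eq_top_iff_vectorSpan_eq_top_of_nonempty ℝ _ _ ⟨0, h0⟩,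
    vectorSpan_eq_span_vsub_set_right ℝ h0]
  simpa using hspan

theorem closure_openDual : closure (openDual C) = closedDual C := by
  have h := convex_closedDual (C := C).closure_interior_eq_closure_of_nonempty_interior
    hC.openDual_nonempty
  rw [isClosed_closedDual.closure_eq] at h
  exact h

theorem openDual_isOpenNondegenerateConvexCone :
    IsOpenNondegenerateConvexCone (openDual C) where
  isCone := by
    refine ⟨hC.openDual_nonempty, fun c hc ξ hξ => ?_⟩
    have hopen : IsOpen {η : StrongDual ℝ V | c⁻¹ • η ∈ openDual C} :=
      isOpen_interior.preimage (continuous_const_smul c⁻¹)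
    refine interior_maximal (fun η hη => ?_) hopen
      (show c⁻¹ • c • ξ ∈ openDual C by rwa [smul_smul, inv_mul_cancel₀ hc.ne', one_smul])
    have h := smul_mem_closedDual (openDual_subset_closedDual hη) hc.le
    rwa [smul_smul, mul_inv_cancel₀ hc.ne', one_smul] at h
  isOpen := isOpen_interior
  convex := convex_closedDual.interior
  nondegenerate := by
    rintro ⟨ξ, η, hη, h⟩
    apply hη
    have hz : ∀ x ∈ C, η x = 0 := by
      intro x hx
      by_contra hne
      have h1 := openDual_subset_closedDual (h (-(ξ x + 1) / η x)) x hx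
      change 0 ≤ ξ x + -(ξ x + 1) / η x * η x at h1
      rw [div_mul_cancel₀ _ hne] at h1
      linarith
    obtain ⟨x, hx⟩ := hC.isCone.1
    obtain ⟨r, hr, h⟩ := hC.exists_norm_form_le hx
    have h1 := h η fun y hy => (hz y hy).ge
    rw [hz x hx] at h1
    exact norm_le_zero_iff.1 (nonpos_of_mul_nonpos_right h1 hr)

theorem mem_closure_of_forall_openDual {x : V} (hx : ∀ ξ ∈ openDual C, 0 ≤ ξ x) :
    x ∈ closure C := by
  refine hC.mem_closure_of_forall_closedDual fun ξ hξ => ?_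
  rw [← hC.closure_openDual] at hξ
  exact closure_minimal (show openDual C ⊆ {ξ | 0 ≤ ξ x} from hx)
    (isClosed_le continuous_const (ContinuousLinearMap.apply ℝ ℝ x).continuous) hξ

end IsOpenNondegenerateConvexCone

end ConeBasics

/-! ### The group action and its contragredient. -/

section Action

variable {V : Type*} [NormedAddCommGroup V] [NormedSpace ℝ V]
  {Γ : Subgroup (V ≃L[ℝ] V)} {S : Set V}

theorem Stabilizes.apply_mem (h : Stabilizes Γ S) {γ : V ≃L[ℝ] V} (hγ : γ ∈ Γ) {x : V}
    (hx : x ∈ S) : γ x ∈ S := by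
  rw [← h γ hγ]
  exact ⟨x, hx, rfl⟩

theorem Stabilizes.symm_apply_mem (h : Stabilizes Γ S) {γ : V ≃L[ℝ] V} (hγ : γ ∈ Γ) {x : V}
    (hx : x ∈ S) : γ.symm x ∈ S :=
  h.apply_mem (Γ.inv_mem hγ) hx

theorem stabilizes_of_forall_apply_mem (h : ∀ γ ∈ Γ, ∀ x ∈ S, γ x ∈ S) : Stabilizes Γ S := by
  intro γ hγ
  refine Set.Subset.antisymm ?_ fun x hx => ⟨γ.symm x, h _ (Γ.inv_mem hγ) x hx, by simp⟩
  rintro _ ⟨x, hx, rfl⟩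
  exact h γ hγ x hx

theorem mem_translates {x : V} : x ∈ translates Γ S ↔ ∃ γ ∈ Γ, ∃ y ∈ S, γ y = x := by
  simp [translates]

theorem translates_singleton_eq {γ : V ≃L[ℝ] V} (hγ : γ ∈ Γ) (x : V) :
    translates Γ {γ x} = translates Γ {x} := by
  ext y
  simp only [mem_translates, Set.mem_singleton_iff, exists_eq_left]
  constructor
  · rintro ⟨δ, hδ, rfl⟩
    exact ⟨δ * γ, Γ.mul_mem hδ hγ, rfl⟩
  · rintro ⟨δ, hδ, rfl⟩
    refine ⟨δ * γ⁻¹, Γ.mul_mem hδ (Γ.inv_mem hγ), ?_⟩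
    change δ (γ.symm (γ x)) = δ x
    simp

theorem Stabilizes.closure (h : Stabilizes Γ S) : Stabilizes Γ (closure S) :=
  stabilizes_of_forall_apply_mem fun γ hγ _ hx =>
    map_mem_closure γ.continuous hx fun _ hy => h.apply_mem hγ hy

theorem Stabilizes.inter {T : Set V} (h : Stabilizes Γ S) (h' : Stabilizes Γ T) :
    Stabilizes Γ (S ∩ T) :=
  stabilizes_of_forall_apply_mem fun _ hγ _ hx => ⟨h.apply_mem hγ hx.1, h'.apply_mem hγ hx.2⟩

theorem Stabilizes.convexHull (h : Stabilizes Γ S) : Stabilizes Γ (convexHull ℝ S) := by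
  intro γ hγ
  have h1 := (γ : V →ₗ[ℝ] V).image_convexHull S
  have h2 : (γ : V →ₗ[ℝ] V) '' S = S := h γ hγ
  rw [h2] at h1
  exact h1

theorem stabilizes_span_rat [Module ℚ V] {ι : Type*} [Fintype ι] (b : Module.Basis ι ℝ V)
    (h : Stabilizes Γ (Submodule.span ℤ (Set.range b) : Set V)) :
    Stabilizes Γ (Submodule.span ℚ (Set.range b) : Set V) := by
  refine stabilizes_of_forall_apply_mem fun γ hγ x hx => ?_
  obtain ⟨n, hn, hnx⟩ := exists_nat_smul_mem_span_int b hx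
  have h1 := span_int_subset_span_rat b (h.apply_mem hγ hnx)
  rw [map_smul] at h1
  have h2 := smul_mem_of_mem_ratSubfield (Submodule.span ℚ (Set.range b)) (a := (n : ℝ)⁻¹)
    (mem_ratSubfield.2 ⟨(n : ℚ)⁻¹, by simp⟩) h1
  rwa [smul_smul, inv_mul_cancel₀ (by positivity), one_smul] at h2

@[simp] theorem contragredientHom_apply (γ : V ≃L[ℝ] V) (ξ : StrongDual ℝ V) (v : V) :
    contragredientHom V γ ξ v = ξ (γ.symm v) := rfl

theorem mem_contragredient {δ : StrongDual ℝ V ≃L[ℝ] StrongDual ℝ V} :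
    δ ∈ contragredient Γ ↔ ∃ γ ∈ Γ, contragredientHom V γ = δ := Subgroup.mem_map

theorem Stabilizes.openDual (h : Stabilizes Γ S) :
    Stabilizes (contragredient Γ) (openDual S) := by
  refine stabilizes_of_forall_apply_mem fun δ hδ ξ hξ => ?_
  obtain ⟨γ, hγ, rfl⟩ := mem_contragredient.1 hδ
  have hopen : IsOpen {η : StrongDual ℝ V | (contragredientHom V γ).symm η ∈
      PolyhedralPair.openDual S} := isOpen_interior.preimage (ContinuousLinearEquiv.continuous _)
  refine interior_maximal (fun η hη x hx => ?_) hopen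
    (show (contragredientHom V γ).symm (contragredientHom V γ ξ) ∈ _ by
      rwa [ContinuousLinearEquiv.symm_apply_apply])
  have h1 := openDual_subset_closedDual hη _ (h.symm_apply_mem hγ hx)
  have h2 : (contragredientHom V γ).symm η (γ.symm x) = η (γ (γ.symm x)) := rfl
  rw [h2] at h1
  simpa using h1

theorem stabilizes_dualLattice {L : Submodule ℤ V} (h : Stabilizes Γ (L : Set V)) :
    Stabilizes (contragredient Γ) (dualLattice L : Set (StrongDual ℝ V)) := by
  refine stabilizes_of_forall_apply_mem fun δ hδ ξ hξ => ?_
  obtain ⟨γ, hγ, rfl⟩ := mem_contragredient.1 hδ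
  intro v hv
  exact hξ _ (h.symm_apply_mem hγ hv)

end Action

/-! ### The rational hull as a cone. -/

section RationalHull

variable {V : Type*} [NormedAddCommGroup V] [NormedSpace ℝ V] [Module ℚ V] {C : Set V}

omit [Module ℚ V] in
theorem smul_mem_hull {S : Set V} {c : ℝ} (hc : 0 ≤ c) {x : V} (hx : x ∈ hull ℝ S) :
    c • x ∈ hull ℝ S :=
  (hull ℝ S).smul_mem hc hx

/-- The rational hull is the convex cone generated by the rational points of the closure. -/
theorem rationalHull_eq_hull (hC : IsOpenNondegenerateConvexCone C) (VQ : Submodule ℚ V) :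
    rationalHull VQ C = (hull ℝ (closure C ∩ (VQ : Set V)) : Set V) := by
  let S := closure C ∩ (VQ : Set V)
  have h0S : (0 : V) ∈ S := ⟨hC.zero_mem_closure, VQ.zero_mem⟩
  have hconv : Convex ℝ (convexHull ℝ S) := convex_convexHull ℝ S
  have h0 : (0 : V) ∈ convexHull ℝ S := subset_convexHull ℝ S h0S
  -- Only rational scalars preserve `S`. A real scaling is an integer dilation followed by a
  -- contraction towards the origin.
  have hnat : ∀ n : ℕ, 0 < n → ∀ x ∈ convexHull ℝ S, (n : ℝ) • x ∈ convexHull ℝ S := by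
    intro n hn x hx
    have h1 := (LinearMap.lsmul ℝ V (n : ℝ)).image_convexHull S
    have h2 : (n : ℝ) • x ∈ LinearMap.lsmul ℝ V (n : ℝ) '' convexHull ℝ S := ⟨x, hx, rfl⟩
    rw [h1] at h2
    refine convexHull_mono ?_ h2
    rintro _ ⟨y, hy, rfl⟩
    exact ⟨hC.smul_mem_closure (by positivity) hy.1, natCast_smul_mem VQ n hy.2⟩
  apply Set.Subset.antisymm
  · exact convexHull_min subset_hull (hull ℝ S).convex
  · intro x hx
    change x ∈ convexHull ℝ S
    induction hx using Submodule.span_induction with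
    | mem x h => exact subset_convexHull ℝ S h
    | zero => exact h0
    | add x y _ _ hx hy =>
      have := hnat 2 two_pos _ (hconv hx hy (a := 1 / 2) (b := 1 / 2) (by norm_num)
        (by norm_num) (by norm_num))
      rw [smul_add, smul_smul, smul_smul] at this
      simpa using this
    | smul a x _ hx =>
      obtain ⟨n, hn⟩ := exists_nat_gt (a : ℝ)
      have hn0 : (0 : ℝ) < n := lt_of_le_of_lt a.2 hn
      have h1 := hnat n (by exact_mod_cast hn0) x hx
      have h2 := hconv.smul_mem_of_zero_mem h0 h1 (t := (a : ℝ) / n)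
        ⟨div_nonneg a.2 hn0.le, (div_le_one hn0).2 hn.le⟩
      rwa [smul_smul, div_mul_cancel₀ _ hn0.ne'] at h2

variable {ι : Type*} [Fintype ι] (b : Module.Basis ι ℝ V)

theorem subset_rationalHull (C : Set V) (hC : IsOpen C) :
    C ⊆ rationalHull (Submodule.span ℚ (Set.range b)) C := fun _ hx =>
  convexHull_mono (Set.inter_subset_inter_left _ subset_closure)
    (mem_convexHull_inter_span_rat b hC hx)

/-- Generators of a cone in the rational hull may be irrational. Enlarging the cone to one with
lattice generators makes subtraction of generators and integrality arguments available. -/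
theorem exists_finset_lattice_generators (hC : IsOpenNondegenerateConvexCone C) (G : Finset V)
    (hG : (G : Set V) ⊆ rationalHull (Submodule.span ℚ (Set.range b)) C) :
    ∃ G' : Finset V, (G' : Set V) ⊆ closure C ∩ (Submodule.span ℤ (Set.range b) : Set V) ∧
      hull ℝ (G : Set V) ≤ hull ℝ (G' : Set V) := by
  classical
  have hle : hull ℝ (closure C ∩ (Submodule.span ℚ (Set.range b) : Set V)) ≤
      hull ℝ (closure C ∩ (Submodule.span ℤ (Set.range b) : Set V)) := by
    refine Submodule.span_le.2 fun x hx => ?_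
    obtain ⟨n, hn, hnx⟩ := exists_nat_smul_mem_span_int b hx.2
    have h1 : (n : ℝ) • x ∈ hull ℝ (closure C ∩ (Submodule.span ℤ (Set.range b) : Set V)) :=
      subset_hull ⟨hC.smul_mem_closure (by positivity) hx.1, hnx⟩
    have h2 := smul_mem_hull (c := (n : ℝ)⁻¹) (by positivity) h1
    rwa [smul_smul, inv_mul_cancel₀ (by positivity), one_smul] at h2
  have hex : ∀ g ∈ G, ∃ T : Finset V,
      (T : Set V) ⊆ closure C ∩ (Submodule.span ℤ (Set.range b) : Set V) ∧
      g ∈ hull ℝ (T : Set V) := fun g hg => by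
    have h1 := hG hg
    rw [rationalHull_eq_hull hC] at h1
    exact Submodule.mem_span_finite_of_mem_span (hle h1)
  choose! T hT hgT using hex
  refine ⟨G.biUnion T, fun x hx => ?_, Submodule.span_le.2 fun g hg => ?_⟩
  · obtain ⟨g, hg, hx⟩ := Finset.mem_biUnion.1 (Finset.mem_coe.1 hx)
    exact hT g hg hx
  · exact Submodule.span_mono (fun y hy => Finset.mem_coe.2 (Finset.mem_biUnion.2 ⟨g, hg, hy⟩))
      (hgT g hg)

omit [Module ℚ V] in
theorem mem_hull_finset_iff {G : Finset V} {x : V} : x ∈ hull ℝ (G : Set V) ↔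
    ∃ a : V → ℝ, (∀ g, 0 ≤ a g) ∧ x = ∑ g ∈ G, a g • g := by
  constructor
  · intro hx
    obtain ⟨f, -, hf⟩ := Submodule.mem_span_finset.1 hx
    exact ⟨fun g => f g, fun g => (f g).2, hf.symm⟩
  · rintro ⟨a, ha, rfl⟩
    exact Submodule.sum_mem _ fun g hg => smul_mem_hull (ha g) (subset_hull hg)

omit [Module ℚ V] in
theorem hull_subset_closure (hC : IsOpenNondegenerateConvexCone C) {G : Set V}
    (hG : G ⊆ closure C) : (hull ℝ G : Set V) ⊆ closure C := by
  intro x hx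
  induction hx using Submodule.span_induction with
  | mem x h => exact hG h
  | zero => exact hC.zero_mem_closure
  | add x y _ _ hx hy => exact hC.add_mem_closure hx hy
  | smul a x _ hx => exact hC.smul_mem_closure_of_nonneg a.2 hx

end RationalHull

/-! ### Minima of forms on lattice points. -/

section Minimizers

variable {V : Type*} [NormedAddCommGroup V] [NormedSpace ℝ V] {C : Set V}

theorem exists_forall_le_of_finite_sublevels {α : Type*} {T : Set α} (hT : T.Nonempty) (φ : α → ℝ)
    (hfin : ∀ c, {t ∈ T | φ t ≤ c}.Finite) : ∃ t ∈ T, ∀ s ∈ T, φ t ≤ φ s := by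
  obtain ⟨t₀, ht₀⟩ := hT
  obtain ⟨t, ht, hmin⟩ := Set.exists_min_image _ φ (hfin (φ t₀)) ⟨t₀, ht₀, le_rfl⟩
  refine ⟨t, ht.1, fun s hs => ?_⟩
  by_cases h : φ s ≤ φ t₀
  · exact hmin s ⟨hs, h⟩
  · exact ht.2.trans (not_le.1 h).le

variable [FiniteDimensional ℝ V] {ι : Type*} [Fintype ι] (b : Module.Basis ι ℝ V)

theorem finite_lattice_sublevel {ξ : StrongDual ℝ V} (hξ : ξ ∈ openDual C) (c : ℝ) :
    {x ∈ C ∩ (Submodule.span ℤ (Set.range b) : Set V) | ξ x ≤ c}.Finite := by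
  obtain ⟨r, hr, h⟩ := exists_norm_le_form hξ
  refine (span_int_finite_inter b (Metric.isBounded_closedBall (x := 0) (r := c / r))).subset ?_
  rintro x ⟨⟨hxC, hxL⟩, hx⟩
  refine ⟨hxL, ?_⟩
  rw [mem_closedBall_zero_iff, le_div_iff₀' hr]
  exact (h x (subset_closure hxC)).trans hx

theorem finite_dualLattice_sublevel (hC : IsOpenNondegenerateConvexCone C) {x : V} (hx : x ∈ C)
    (c : ℝ) : {ξ ∈ openDual C ∩ (dualLattice (Submodule.span ℤ (Set.range b)) :
      Set (StrongDual ℝ V)) | ξ x ≤ c}.Finite := by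
  obtain ⟨r, hr, h⟩ := hC.exists_norm_form_le hx
  rw [dualLattice_span_int]
  refine (span_int_finite_inter (strongDualBasis b)
    (Metric.isBounded_closedBall (x := 0) (r := c / r))).subset ?_
  rintro ξ ⟨⟨hξC, hξL⟩, hξ⟩
  refine ⟨hξL, ?_⟩
  rw [mem_closedBall_zero_iff, le_div_iff₀' hr]
  exact (h ξ (openDual_subset_closedDual hξC)).trans hξ

theorem exists_dual_minimizer (hC : IsOpenNondegenerateConvexCone C) {x : V} (hx : x ∈ C) :
    ∃ e ∈ openDual C ∩ (dualLattice (Submodule.span ℤ (Set.range b)) : Set (StrongDual ℝ V)),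
      ∀ e' ∈ openDual C ∩ (dualLattice (Submodule.span ℤ (Set.range b)) :
        Set (StrongDual ℝ V)), e x ≤ e' x := by
  refine exists_forall_le_of_finite_sublevels ?_ (fun ξ : StrongDual ℝ V => ξ x)
    (finite_dualLattice_sublevel b hC hx)
  obtain ⟨l, hl, hlC⟩ := IsCone.exists_lattice_point
    hC.openDual_isOpenNondegenerateConvexCone.isCone isOpen_interior (strongDualBasis b)
  rw [dualLattice_span_int]
  exact ⟨l, hlC, hl⟩

/-- A form in the open dual attains its minimum on the lattice points of the cone at an extreme
point of their convex hull. -/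
theorem exists_extreme_minimizer (hC : IsOpenNondegenerateConvexCone C) {ξ : StrongDual ℝ V}
    (hξ : ξ ∈ openDual C) :
    ∃ e ∈ Set.extremePoints ℝ (convexHull ℝ (C ∩ (Submodule.span ℤ (Set.range b) : Set V))),
      ∀ x ∈ C ∩ (Submodule.span ℤ (Set.range b) : Set V), ξ e ≤ ξ x := by
  let X : Set V := C ∩ (Submodule.span ℤ (Set.range b) : Set V)
  have hX : X.Nonempty := by
    obtain ⟨l, hl, hlC⟩ := IsCone.exists_lattice_point hC.isCone hC.isOpen b
    exact ⟨l, hlC, hl⟩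
  obtain ⟨m, hm, hmin⟩ := exists_forall_le_of_finite_sublevels hX ξ (finite_lattice_sublevel b hξ)
  let M : Set V := {x ∈ X | ξ x ≤ ξ m}
  have hM : M.Finite := finite_lattice_sublevel b hξ _
  obtain ⟨e, he⟩ := (hM.isCompact_convexHull (𝕜 := ℝ)).extremePoints_nonempty
    ⟨m, subset_convexHull ℝ M ⟨hm, le_rfl⟩⟩
  have heM : e ∈ M := extremePoints_convexHull_subset he
  have hconvM : Convex ℝ (convexHull ℝ M) := convex_convexHull ℝ M
  have hMle : ∀ z ∈ convexHull ℝ M, ξ z = ξ m := by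
    have : convexHull ℝ M ⊆ {z | ξ z = ξ m} :=
      convexHull_min (fun z hz => le_antisymm hz.2 (hmin z hz.1))
        (convex_hyperplane (ξ : V →ₗ[ℝ] ℝ).isLinear (ξ m))
    exact this
  -- The hull of the finite set `M` of minimizers is a face of the hull of `X`, so its extreme
  -- points are extreme in the whole.
  have hsplit : convexHull ℝ X ⊆ {z | ξ m < ξ z} ∪ convexHull ℝ M := by
    refine convexHull_min (fun z hz => ?_) ?_
    · rcases (hmin z hz).lt_or_eq with h | h
      · exact Or.inl h
      · exact Or.inr (subset_convexHull ℝ M ⟨hz, h.ge⟩)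
    · rw [convex_iff_forall_pos]
      have hge : ∀ z ∈ {z | ξ m < ξ z} ∪ convexHull ℝ M, ξ m ≤ ξ z := fun z hz =>
        hz.elim (fun h => le_of_lt h) (fun h => (hMle z h).ge)
      intro y hy z hz s t hs ht hst
      by_cases hyz : y ∈ convexHull ℝ M ∧ z ∈ convexHull ℝ M
      · exact Or.inr (hconvM hyz.1 hyz.2 hs.le ht.le hst)
      · left
        change ξ m < ξ (s • y + t • z)
        rw [map_add, map_smul, map_smul, smul_eq_mul, smul_eq_mul]
        have h1 := hge y hy
        have h2 := hge z hz
        have h3 : ξ m = s * ξ m + t * ξ m := by rw [← add_mul, hst, one_mul]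
        rw [h3]
        rcases not_and_or.1 hyz with h | h
        · have : ξ m < ξ y := hy.resolve_right h
          nlinarith
        · have : ξ m < ξ z := hz.resolve_right h
          nlinarith
  refine ⟨e, ?_, fun x hx => heM.2.trans (hmin x hx)⟩
  rw [mem_extremePoints]
  refine ⟨subset_convexHull ℝ X heM.1, fun y hy z hz hyz => ?_⟩
  have hem : ξ e = ξ m := hMle e he.1
  have hge : ∀ z ∈ convexHull ℝ X, ξ m ≤ ξ z := fun z hz =>
    (hsplit hz).elim (fun h => le_of_lt h) (fun h => (hMle z h).ge)
  obtain ⟨s, t, hs, ht, hst, heq⟩ := hyz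
  have hval : s * ξ y + t * ξ z = s * ξ m + t * ξ m := by
    rw [← add_mul, hst, one_mul, ← hem, ← heq]
    simp
  have h1 := hge y hy
  have h2 := hge z hz
  have hyM : y ∈ convexHull ℝ M := (hsplit hy).resolve_left fun h => by
    have : ξ m < ξ y := h
    nlinarith
  have hzM : z ∈ convexHull ℝ M := (hsplit hz).resolve_left fun h => by
    have : ξ m < ξ z := h
    nlinarith
  exact (mem_extremePoints.1 he).2 y hyM z hzM ⟨s, t, hs, ht, hst, heq⟩

end Minimizers

/-! ### Normal cones at lattice points. -/

section NormalCones

variable {V : Type*} [NormedAddCommGroup V] [NormedSpace ℝ V] {C : Set V}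
  [FiniteDimensional ℝ V] {ι : Type*} [Fintype ι] (b : Module.Basis ι ℝ V)

omit [FiniteDimensional ℝ V] in
-- Were the form negative somewhere on `C`, the open cone `C ∩ {ξ < 0}` would contain a lattice
-- point, whose multiples make the form unbounded below.
theorem nonneg_of_minimized (hC : IsOpenNondegenerateConvexCone C) {e : V} {ξ : StrongDual ℝ V}
    (h : ∀ x ∈ C ∩ (Submodule.span ℤ (Set.range b) : Set V), ξ e ≤ ξ x) :
    ξ ∈ closedDual C := by
  intro c hc
  by_contra! hneg
  have hcone : IsCone (C ∩ {x | ξ x < 0}) := by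
    refine ⟨⟨c, hc, hneg⟩, fun t ht x hx => ⟨hC.smul_mem ht hx.1, ?_⟩⟩
    change ξ (t • x) < 0
    rw [map_smul]
    exact mul_neg_of_pos_of_neg ht hx.2
  obtain ⟨l, hl, hlC, hl0⟩ := hcone.exists_lattice_point
    (hC.isOpen.inter (isOpen_lt ξ.continuous continuous_const)) b
  have hl0 : ξ l < 0 := hl0
  obtain ⟨n, hn⟩ := exists_nat_gt (|ξ e| / -ξ l)
  have hn0 : (0 : ℝ) < n := lt_of_le_of_lt (div_nonneg (abs_nonneg _) (by linarith)) hn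
  have h1 := h _ ⟨hC.smul_mem hn0 hlC, natCast_smul_mem_int _ n hl⟩
  rw [map_smul, smul_eq_mul] at h1
  rw [div_lt_iff₀ (by linarith)] at hn
  linarith [neg_abs_le (ξ e)]

/-- The forms that are minimal at a given lattice point of the cone are contained in a cone
generated by finitely many rational forms that are nonnegative on the cone. -/
theorem exists_finset_normalCone [Module ℚ V] (hC : IsOpenNondegenerateConvexCone C) {e : V}
    (he : e ∈ C ∩ (Submodule.span ℤ (Set.range b) : Set V)) :
    ∃ H : Finset (StrongDual ℝ V), (H : Set (StrongDual ℝ V)) ⊆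
      closedDual C ∩ (dualRational (Submodule.span ℚ (Set.range b)) : Set (StrongDual ℝ V)) ∧
      ∀ ξ : StrongDual ℝ V,
        (∀ x ∈ C ∩ (Submodule.span ℤ (Set.range b) : Set V), ξ e ≤ ξ x) →
        ξ ∈ hull ℝ (H : Set (StrongDual ℝ V)) := by
  let L := Submodule.span ℤ (Set.range b)
  -- Applied to `C - e`, which contains the origin because `e` lies in `C`; minimality at `e`
  -- becomes nonnegativity on `G`.
  obtain ⟨G, hG, hG'⟩ := exists_finset_generating_lattice_points (Module.finrank ℝ V) V rfl
    L.toAddSubgroup (fun R => span_int_finite_inter b Metric.isBounded_closedBall)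
    (∑ i, ‖b i‖) (span_int_cocompact b) ((fun v => e + v) ⁻¹' C)
    (hC.convex.translate_preimage_right e) (hC.isOpen.preimage (continuous_const_add e))
    (by simpa using he.1)
  have hGL : ∀ g ∈ G, e + g ∈ C ∩ (L : Set V) := fun g hg =>
    ⟨(hG hg).1, L.add_mem he.2 (hG hg).2⟩
  have key : ∀ ξ : StrongDual ℝ V, (∀ g ∈ G, 0 ≤ ξ g) ↔ ∀ x ∈ C ∩ (L : Set V), ξ e ≤ ξ x := by
    intro ξ
    constructor
    · intro h x hx
      have h1 : x - e ∈ hull ℝ (G : Set V) := hG' ⟨by simpa using hx.1, L.sub_mem hx.2 he.2⟩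
      have h2 := nonneg_of_mem_hull (f := (ξ : V →ₗ[ℝ] ℝ)) h h1
      simpa using h2
    · intro h g hg
      have := h _ (hGL g hg)
      rw [map_add] at this
      linarith
  obtain ⟨H, hH, hH'⟩ := exists_finset_rational_forms b G
    (fun g hg => span_int_subset_span_rat b (hG hg).2)
  refine ⟨H, fun η hη => ⟨?_, hH hη⟩, fun ξ hξ => (hH' ξ).1 ((key ξ).2 hξ)⟩
  exact nonneg_of_minimized b hC ((key η).1 ((hH' η).2 (subset_hull hη)))

/-- If there are finitely many orbits of extreme points, then finitely many rational forms generate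
a cone whose translates cover the open dual cone. -/
theorem exists_finset_covering_forms [Module ℚ V] (hC : IsOpenNondegenerateConvexCone C)
    {Γ : Subgroup (V ≃L[ℝ] V)} (hΓC : Stabilizes Γ C)
    (hΓL : Stabilizes Γ (Submodule.span ℤ (Set.range b) : Set V))
    (hfin : FinitelyManyExtremeOrbits C (Submodule.span ℤ (Set.range b)) Γ) :
    ∃ H : Finset (StrongDual ℝ V), (H : Set (StrongDual ℝ V)) ⊆
      closedDual C ∩ (dualRational (Submodule.span ℚ (Set.range b)) : Set (StrongDual ℝ V)) ∧
      ∀ ξ ∈ openDual C, ∃ γ ∈ Γ, ξ.comp (γ : V →L[ℝ] V) ∈ hull ℝ (H : Set (StrongDual ℝ V)) := by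
  classical
  let X := C ∩ (Submodule.span ℤ (Set.range b) : Set V)
  choose! H hH hH' using fun e (he : e ∈ X) => exists_finset_normalCone b hC he
  have hrep : ∀ O ∈ {O : Set V | ∃ x ∈ Set.extremePoints ℝ (convexHull ℝ X),
      O = translates Γ {x}}, ∃ x ∈ X, O = translates Γ {x} := by
    rintro O ⟨x, hx, hO⟩
    exact ⟨x, extremePoints_convexHull_subset hx, hO⟩
  choose! rep hrepX hrep using hrep
  have hfin' : {O : Set V | ∃ x ∈ Set.extremePoints ℝ (convexHull ℝ X),
      O = translates Γ {x}}.Finite := hfin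
  refine ⟨hfin'.toFinset.biUnion fun O => H (rep O), ?_, fun ξ hξ => ?_⟩
  · intro η hη
    obtain ⟨O, hO, hη⟩ := Finset.mem_biUnion.1 (Finset.mem_coe.1 hη)
    exact hH _ (hrepX O (hfin'.mem_toFinset.1 hO)) hη
  · obtain ⟨e, he, hmin⟩ := exists_extreme_minimizer b hC hξ
    have hO : translates Γ {e} ∈ {O : Set V | ∃ x ∈ Set.extremePoints ℝ (convexHull ℝ X),
      O = translates Γ {x}} := ⟨e, he, rfl⟩
    have h1 : e ∈ translates Γ {rep (translates Γ {e})} := by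
      rw [← hrep _ hO]
      exact mem_translates.2 ⟨1, Γ.one_mem, e, rfl, rfl⟩
    obtain ⟨γ, hγ, _, rfl, hγe⟩ := mem_translates.1 h1
    refine ⟨γ, hγ, ?_⟩
    refine Submodule.span_mono (fun η hη => Finset.mem_coe.2 (Finset.mem_biUnion.2
      ⟨translates Γ {e}, hfin'.mem_toFinset.2 hO, hη⟩)) (hH' _ (hrepX _ hO) _ fun x hx => ?_)
    change ξ (γ (rep (translates Γ {e}))) ≤ ξ (γ x)
    rw [hγe]
    exact hmin _ ((hΓC.inter hΓL).apply_mem hγ hx)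

end NormalCones

/-! ### From a covering cone to finitely many extreme orbits. -/

section ExtremeOrbits

variable {V : Type*} [NormedAddCommGroup V] [NormedSpace ℝ V] {C : Set V}

/-- A point of the cone stays in the cone if a generator is subtracted whose coefficient exceeds
one. -/
theorem sub_mem_of_one_lt_coeff (hC : IsOpenNondegenerateConvexCone C) {G : Finset V}
    (hG : (G : Set V) ⊆ closure C) {a : V → ℝ} (ha : ∀ g, 0 ≤ a g)
    (hx : ∑ g ∈ G, a g • g ∈ C) {g : V} (hg : g ∈ G) (hag : 1 < a g) :
    ∑ g ∈ G, a g • g - g ∈ C := by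
  classical
  have hrest : ∑ h ∈ G.erase g, a h • h ∈ closure C :=
    hull_subset_closure hC ((Finset.coe_subset.2 (Finset.erase_subset g G)).trans hG)
      (mem_hull_finset_iff.2 ⟨a, ha, rfl⟩)
  have hsum := Finset.add_sum_erase G (fun h => a h • h) hg
  have ha0 : 0 < a g := by linarith
  -- A positive multiple of the point itself is split off, which keeps the difference in the open
  -- cone and not just in its closure.
  have heq : ∑ g ∈ G, a g • g - g = (1 - (a g)⁻¹) • (∑ g ∈ G, a g • g) +
      (a g)⁻¹ • ∑ h ∈ G.erase g, a h • h := by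
    have hmul : (1 - (a g)⁻¹) * a g = a g - 1 := by field_simp
    rw [← hsum, smul_add, smul_smul, hmul]
    module
  rw [heq]
  exact hC.add_mem_of_closure (hC.smul_mem (sub_pos.2 (inv_lt_one_of_one_lt₀ hag)) hx)
    (hC.smul_mem_closure (inv_pos.2 ha0) hrest)

variable [FiniteDimensional ℝ V] [Module ℚ V] {ι : Type*} [Fintype ι] (b : Module.Basis ι ℝ V)
  {Γ : Subgroup (V ≃L[ℝ] V)}

/-- Let `y` be a translate in the cone of an extreme point. If a nonzero generator `g` had
coefficient above 1, both `y - g` and `y + g` would lie in `C ∩ L`, against extremality. So each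
orbit meets a fixed ball. -/
theorem finitelyManyExtremeOrbits_of_hasCoveringCone (hC : IsOpenNondegenerateConvexCone C)
    (hΓC : Stabilizes Γ C) (hΓL : Stabilizes Γ (Submodule.span ℤ (Set.range b) : Set V))
    (h : HasCoveringCone (Submodule.span ℚ (Set.range b)) C Γ) :
    FinitelyManyExtremeOrbits C (Submodule.span ℤ (Set.range b)) Γ := by
  let L := Submodule.span ℤ (Set.range b)
  obtain ⟨P, hP, hPsub, hPcov⟩ := h
  obtain ⟨G₀, rfl⟩ := hP.exists_eq_hull
  obtain ⟨G, hG, hle⟩ := exists_finset_lattice_generators b hC G₀ (subset_hull.trans hPsub)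
  have hfin : ((L : Set V) ∩ Metric.closedBall 0 (∑ g ∈ G, ‖g‖)).Finite :=
    span_int_finite_inter b Metric.isBounded_closedBall
  refine (hfin.image fun x => translates Γ {x}).subset ?_
  rintro _ ⟨e, he, rfl⟩
  have heX : e ∈ C ∩ (L : Set V) := extremePoints_convexHull_subset he
  obtain ⟨γ, hγ, y, hy, rfl⟩ := mem_translates.1 (hPcov heX.1)
  have hyC : y ∈ C := by simpa using hΓC.symm_apply_mem hγ heX.1
  have hyL : y ∈ (L : Set V) := by simpa using hΓL.symm_apply_mem hγ heX.2
  refine ⟨y, ⟨hyL, ?_⟩, (translates_singleton_eq hγ y).symm⟩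
  obtain ⟨a, ha, hya⟩ := mem_hull_finset_iff.1 (hle hy)
  have hbound : ∀ g ∈ G, ‖a g • g‖ ≤ ‖g‖ := by
    intro g hg
    rw [norm_smul, Real.norm_of_nonneg (ha g)]
    rcases eq_or_ne g 0 with rfl | hg0
    · simp
    refine mul_le_of_le_one_left (norm_nonneg _) ?_
    by_contra! hag
    have hsub : y - g ∈ C := by
      rw [hya] at hyC ⊢
      exact sub_mem_of_one_lt_coeff hC (fun g hg => (hG hg).1) ha hyC hg hag
    have hadd : y + g ∈ C := hC.add_mem_of_closure hyC (hG hg).1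
    have h1 : γ (y - g) ∈ C ∩ (L : Set V) :=
      (hΓC.inter hΓL).apply_mem hγ ⟨hsub, L.sub_mem hyL (hG hg).2⟩
    have h2 : γ (y + g) ∈ C ∩ (L : Set V) :=
      (hΓC.inter hΓL).apply_mem hγ ⟨hadd, L.add_mem hyL (hG hg).2⟩
    have h3 := (mem_extremePoints.1 he).2 _ (subset_convexHull ℝ _ h1) _
      (subset_convexHull ℝ _ h2) ⟨1 / 2, 1 / 2, by norm_num, by norm_num, by norm_num, by
        rw [← map_smul, ← map_smul, ← map_add]
        congr 1
        module⟩
    have h4 : y - g = y := γ.injective h3.1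
    exact hg0 (by simpa using h4)
  rw [mem_closedBall_zero_iff, hya]
  exact (norm_sum_le _ _).trans (Finset.sum_le_sum hbound)

end ExtremeOrbits

/-! ### Finiteness of minimizers and closure of the covering. -/

section Siegel

variable {V : Type*} [NormedAddCommGroup V] [NormedSpace ℝ V] {C : Set V}
  [FiniteDimensional ℝ V] {ι : Type*} [Fintype ι] (b : Module.Basis ι ℝ V)

/-- The forms in the dual lattice that are minimal at some point with prescribed support in a
rational polyhedral cone form a finite set. -/
theorem finite_minimizers_of_support (hC : IsOpenNondegenerateConvexCone C) (I : Finset V)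
    (hI : (I : Set V) ⊆ closure C ∩ (Submodule.span ℤ (Set.range b) : Set V)) :
    {e ∈ openDual C ∩ (dualLattice (Submodule.span ℤ (Set.range b)) : Set (StrongDual ℝ V)) |
      ∃ a : V → ℝ, (∀ g ∈ I, 0 < a g) ∧ ∑ g ∈ I, a g • g ∈ C ∧
        ∀ e' ∈ openDual C ∩ (dualLattice (Submodule.span ℤ (Set.range b)) :
          Set (StrongDual ℝ V)), e (∑ g ∈ I, a g • g) ≤ e' (∑ g ∈ I, a g • g)}.Finite := by
  set S := openDual C ∩ (dualLattice (Submodule.span ℤ (Set.range b)) : Set (StrongDual ℝ V))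
  set E := {e ∈ S | ∃ a : V → ℝ, (∀ g ∈ I, 0 < a g) ∧ ∑ g ∈ I, a g • g ∈ C ∧
        ∀ e' ∈ S, e (∑ g ∈ I, a g • g) ≤ e' (∑ g ∈ I, a g • g)}
  -- On `S` the floor loses nothing: the values at lattice points of the closure of `C` are
  -- nonnegative integers.
  let f : StrongDual ℝ V → I → ℕ := fun e g => ⌊e g⌋₊
  have hf : ∀ e ∈ S, ∀ g : I, (f e g : ℝ) = e g := by
    intro e he g
    obtain ⟨n, hn⟩ := he.2 g (hI g.2).2
    have h0 : 0 ≤ e g := closedDual_nonneg_closure (openDual_subset_closedDual he.1) (hI g.2).1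
    have hn0 : 0 ≤ n := by rw [hn] at h0; exact_mod_cast h0
    lift n to ℕ using hn0
    simp only [f]
    rw [hn]
    simp
  have hval : ∀ e e' : StrongDual ℝ V, (∀ g ∈ I, e g = e' g) → ∀ a : V → ℝ,
      e (∑ g ∈ I, a g • g) = e' (∑ g ∈ I, a g • g) := by
    intro e e' h a
    rw [map_sum, map_sum]
    exact Finset.sum_congr rfl fun g hg => by rw [map_smul, map_smul, h g hg]
  refine Set.Finite.of_finite_fibers f ?_ ?_
  -- Dickson's lemma: antichains in `ℕ^I` are finite. Strict positivity of all coefficients of the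
  -- minimized point turns a comparison of value vectors into equality.
  · have hanti : IsAntichain (· ≤ ·) (f '' E) := by
      rintro _ ⟨e₁, he₁, rfl⟩ _ ⟨e₂, he₂, rfl⟩ hne hle
      apply hne
      have hle' : ∀ g ∈ I, e₁ g ≤ e₂ g := fun g hg => by
        rw [← hf e₁ he₁.1 ⟨g, hg⟩, ← hf e₂ he₂.1 ⟨g, hg⟩]
        exact_mod_cast hle ⟨g, hg⟩
      obtain ⟨a, ha, -, hmin⟩ := he₂.2
      have h1 := hmin e₁ he₁.1
      rw [map_sum, map_sum] at h1
      have h2 : ∀ g ∈ I, e₁ (a g • g) ≤ e₂ (a g • g) := fun g hg => by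
        rw [map_smul, map_smul]
        exact mul_le_mul_of_nonneg_left (hle' g hg) (ha g hg).le
      have h3 := (Finset.sum_eq_sum_iff_of_le h2).1 (le_antisymm (Finset.sum_le_sum h2) h1)
      funext g
      have h4 := h3 g g.2
      rw [map_smul, map_smul, smul_eq_mul, smul_eq_mul] at h4
      have h5 := mul_left_cancel₀ (ha g g.2).ne' h4
      rw [← hf e₁ he₁.1 g, ← hf e₂ he₂.1 g] at h5
      exact_mod_cast h5
    exact hanti.finite_of_partiallyWellOrderedOn (Set.isPWO_of_wellQuasiOrderedLE _)
  · rintro _ ⟨e₀, he₀, rfl⟩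
    obtain ⟨a, ha, hx, -⟩ := he₀.2
    refine (finite_dualLattice_sublevel b hC hx (e₀ (∑ g ∈ I, a g • g))).subset ?_
    rintro e ⟨he, hfe⟩
    refine ⟨he.1, (hval e e₀ (fun g hg => ?_) a).le⟩
    rw [← hf e he.1 ⟨g, hg⟩, ← hf e₀ he₀.1 ⟨g, hg⟩]
    have hfe : f e = f e₀ := hfe
    rw [hfe]

/-- The forms in the dual lattice that are minimal at some interior point of a rational polyhedral
cone form a finite set. -/
theorem finite_minimizers (hC : IsOpenNondegenerateConvexCone C) (G : Finset V)
    (hG : (G : Set V) ⊆ closure C ∩ (Submodule.span ℤ (Set.range b) : Set V)) :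
    {e ∈ openDual C ∩ (dualLattice (Submodule.span ℤ (Set.range b)) : Set (StrongDual ℝ V)) |
      ∃ x ∈ C, x ∈ hull ℝ (G : Set V) ∧
        ∀ e' ∈ openDual C ∩ (dualLattice (Submodule.span ℤ (Set.range b)) :
          Set (StrongDual ℝ V)), e x ≤ e' x}.Finite := by
  classical
  -- Sorting points by the generators with nonzero coefficient secures the strict positivity.
  refine (G.powerset.finite_toSet.biUnion fun I hI => finite_minimizers_of_support b hC I
    ((Finset.coe_subset.2 (Finset.mem_powerset.1 hI)).trans hG)).subset ?_
  rintro e ⟨he, x, hx, hxG, hmin⟩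
  obtain ⟨a, ha, rfl⟩ := mem_hull_finset_iff.1 hxG
  have hsum : ∑ g ∈ G with 0 < a g, a g • g = ∑ g ∈ G, a g • g := by
    refine Finset.sum_filter_of_ne fun g _ hne => (ha g).lt_of_ne fun h => hne ?_
    rw [← h, zero_smul]
  refine Set.mem_iUnion₂.2 ⟨G.filter fun g => 0 < a g,
    Finset.mem_coe.2 (Finset.mem_powerset.2 (Finset.filter_subset _ _)), he, a,
    fun g hg => (Finset.mem_filter.1 hg).2, ?_⟩
  rw [hsum]
  exact ⟨hx, hmin⟩

/-- Only finitely many lattice automorphisms of the cone carry a given form in the open dual to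
another one. -/
theorem finite_transporter (hC : IsOpenNondegenerateConvexCone C) {Γ : Subgroup (V ≃L[ℝ] V)}
    (hΓC : Stabilizes Γ C) (hΓL : Stabilizes Γ (Submodule.span ℤ (Set.range b) : Set V))
    {e : StrongDual ℝ V} (he : e ∈ openDual C) (e' : StrongDual ℝ V) :
    {γ : V ≃L[ℝ] V | γ ∈ Γ ∧ ∀ v, e (γ v) = e' v}.Finite := by
  let L := Submodule.span ℤ (Set.range b)
  obtain ⟨l, hl, hlC⟩ := IsCone.exists_lattice_point hC.isCone hC.isOpen b
  obtain ⟨r, hr, hball⟩ := Metric.isOpen_iff.1 hC.isOpen l hlC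
  obtain ⟨N, hN⟩ := exists_nat_gt ((∑ i, ‖b i‖) / r)
  have hN0 : (0 : ℝ) < N :=
    lt_of_le_of_lt (div_nonneg (Finset.sum_nonneg fun i _ => norm_nonneg _) hr.le) hN
  -- These points and `N • l` lie in `C ∩ L` and determine a linear map; a transporter sends each of
  -- them into a finite sublevel set of `e`.
  have hp : ∀ i, (N : ℝ) • l + b i ∈ C ∩ (L : Set V) := by
    intro i
    refine ⟨?_, L.add_mem (natCast_smul_mem_int L N hl) (Submodule.subset_span ⟨i, rfl⟩)⟩
    have h1 : l + (N : ℝ)⁻¹ • b i ∈ C := by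
      apply hball
      rw [mem_ball_iff_norm, add_sub_cancel_left, norm_smul,
        Real.norm_of_nonneg (inv_nonneg.2 hN0.le), inv_mul_lt_iff₀ hN0]
      rw [div_lt_iff₀ hr] at hN
      exact (Finset.single_le_sum (f := fun i => ‖b i‖) (fun i _ => norm_nonneg _)
        (Finset.mem_univ i)).trans_lt hN
    have h2 := hC.smul_mem hN0 h1
    rwa [smul_add, smul_smul, mul_inv_cancel₀ hN0.ne', one_smul] at h2
  have hp0 : (N : ℝ) • l ∈ C ∩ (L : Set V) :=
    ⟨hC.smul_mem hN0 hlC, natCast_smul_mem_int L N hl⟩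
  let p : Option ι → V := fun o => o.elim ((N : ℝ) • l) fun i => (N : ℝ) • l + b i
  have hpC : ∀ o, p o ∈ C ∩ (L : Set V) := fun o => by
    cases o with
    | none => exact hp0
    | some i => exact hp i
  have hfin : (Set.univ.pi fun o => {x ∈ C ∩ (L : Set V) | e x ≤ e' (p o)}).Finite :=
    Set.Finite.pi fun o => finite_lattice_sublevel b he _
  refine Set.Finite.of_injOn (f := fun (γ : V ≃L[ℝ] V) o => γ (p o)) ?_ ?_ hfin
  · rintro γ ⟨hγ, hγe⟩ o -
    exact ⟨(hΓC.inter hΓL).apply_mem hγ (hpC o), (hγe _).le⟩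
  · rintro γ - δ - heq
    have h0 : γ ((N : ℝ) • l) = δ ((N : ℝ) • l) := congrFun heq none
    have h1 : (γ : V →ₗ[ℝ] V) = (δ : V →ₗ[ℝ] V) := by
      refine b.ext fun i => ?_
      have h2 : γ ((N : ℝ) • l + b i) = δ ((N : ℝ) • l + b i) := congrFun heq (some i)
      rw [map_add, map_add, h0] at h2
      exact add_left_cancel h2
    ext v
    exact DFunLike.congr_fun h1 v

/-- If the translates of a polyhedral cone in the rational hull cover the open cone, then they cover
the rational hull. -/
theorem translates_eq_rationalHull [Module ℚ V] (hC : IsOpenNondegenerateConvexCone C)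
    {Γ : Subgroup (V ≃L[ℝ] V)} (hΓC : Stabilizes Γ C)
    (hΓL : Stabilizes Γ (Submodule.span ℤ (Set.range b) : Set V)) {P : Set V}
    (hP : IsPolyhedralCone P) (hsub : P ⊆ rationalHull (Submodule.span ℚ (Set.range b)) C)
    (hcov : C ⊆ translates Γ P) :
    translates Γ P = rationalHull (Submodule.span ℚ (Set.range b)) C := by
  classical
  have hstab : Stabilizes Γ (rationalHull (Submodule.span ℚ (Set.range b)) C) :=
    (hΓC.closure.inter (stabilizes_span_rat b hΓL)).convexHull
  refine Set.Subset.antisymm ?_ fun x hx => ?_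
  · intro x hx
    obtain ⟨γ, hγ, y, hy, rfl⟩ := mem_translates.1 hx
    exact hstab.apply_mem hγ (hsub hy)
  obtain ⟨G₀, rfl⟩ := hP.exists_eq_hull
  obtain ⟨G, hG, hle⟩ := exists_finset_lattice_generators b hC G₀ (subset_hull.trans hsub)
  obtain ⟨p, hp⟩ := hC.isCone.1
  -- One cone `K` contains `x` and the whole sequence `x + s n • p` in `C` that converges to it.
  obtain ⟨K, hK, hleK⟩ := exists_finset_lattice_generators b hC {x, p} (by
    intro y hy
    rcases (by simpa using hy : y = x ∨ y = p) with rfl | rfl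
    exacts [hx, subset_rationalHull b C hC.isOpen hp])
  let s : ℕ → ℝ := fun n => 1 / ((n : ℝ) + 1)
  have hs0 : ∀ n, 0 < s n := fun n => by positivity
  let y : ℕ → V := fun n => x + s n • p
  have hxcl : x ∈ closure C := by
    rw [rationalHull_eq_hull hC] at hx
    exact hull_subset_closure hC Set.inter_subset_left hx
  have hyC : ∀ n, y n ∈ C := fun n => by
    simp only [y]
    rw [add_comm]
    exact hC.add_mem_of_closure (hC.smul_mem (hs0 n) hp) hxcl
  have hyK : ∀ n, y n ∈ hull ℝ (K : Set V) := fun n => hleK <|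
    Submodule.add_mem _ (subset_hull (by simp)) (smul_mem_hull (hs0 n).le (subset_hull (by simp)))
  have hylim : Tendsto y atTop (𝓝 x) := by
    have h1 : Tendsto s atTop (𝓝 0) := tendsto_one_div_add_atTop_nhds_zero_nat
    simpa [y] using (h1.smul_const p).const_add x
  let S := openDual C ∩ (dualLattice (Submodule.span ℤ (Set.range b)) : Set (StrongDual ℝ V))
  have hSstab : Stabilizes (contragredient Γ) S := hΓC.openDual.inter (stabilizes_dualLattice hΓL)
  -- If `γ z = y n` and `e` is minimal at `y n`, then `e ∘ γ` is minimal at `z`. So `γ` transports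
  -- between two finite sets of minimizers.
  let T : Set (V ≃L[ℝ] V) := ⋃ e ∈ {e ∈ S | ∃ x ∈ C, x ∈ hull ℝ (K : Set V) ∧
      ∀ e' ∈ S, e x ≤ e' x}, ⋃ e' ∈ {e ∈ S | ∃ x ∈ C, x ∈ hull ℝ (G : Set V) ∧
      ∀ e' ∈ S, e x ≤ e' x}, {γ : V ≃L[ℝ] V | γ ∈ Γ ∧ ∀ v, e (γ v) = e' v}
  have hT : T.Finite := (finite_minimizers b hC K hK).biUnion fun e he =>
    (finite_minimizers b hC G hG).biUnion fun e' _ => finite_transporter b hC hΓC hΓL he.1.1 e'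
  have hγ : ∀ n, ∃ γ ∈ T, γ ∈ Γ ∧ ∃ z ∈ (hull ℝ (G₀ : Set V) : Set V), γ z = y n := by
    intro n
    obtain ⟨γ, hγ, z, hz, hzy⟩ := mem_translates.1 (hcov (hyC n))
    obtain ⟨e, heS, hmin⟩ := exists_dual_minimizer b hC (hyC n)
    refine ⟨γ, ?_, hγ, z, hz, hzy⟩
    have hcomp : ∀ η ∈ S, η.comp (γ : V →L[ℝ] V) ∈ S := fun η hη =>
      hSstab.symm_apply_mem (mem_contragredient.2 ⟨γ, hγ, rfl⟩) hη
    have hcomp' : ∀ η ∈ S, η.comp (γ.symm : V →L[ℝ] V) ∈ S := fun η hη =>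
      hSstab.apply_mem (mem_contragredient.2 ⟨γ, hγ, rfl⟩) hη
    refine Set.mem_iUnion₂.2 ⟨e, ⟨heS, y n, hyC n, hyK n, hmin⟩, Set.mem_iUnion₂.2
      ⟨e.comp (γ : V →L[ℝ] V), ⟨hcomp e heS, z, ?_, hle hz, fun e' he' => ?_⟩, hγ,
        fun v => rfl⟩⟩
    · have := hΓC.symm_apply_mem hγ (hyC n)
      rw [← hzy] at this
      simpa using this
    · have h1 := hmin _ (hcomp' e' he')
      rw [← hzy] at h1
      simpa using h1
  choose γ hγT hγΓ z hz hzy using hγ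
  have : Finite T := hT
  -- One group element serves infinitely many `n`, and its translate of the cone is closed, so it
  -- contains the limit `x`.
  obtain ⟨δ, hδ⟩ := Finite.exists_infinite_fiber fun n => (⟨γ n, hγT n⟩ : T)
  have hfreq : ∃ᶠ n in atTop, γ n = δ := by
    rw [Nat.frequently_atTop_iff_infinite]
    convert Set.infinite_coe_iff.1 hδ using 1
    ext n
    simp [Subtype.ext_iff]
  obtain ⟨m, hm⟩ := hfreq.exists
  have hclosed : IsClosed {v : V | (δ : V ≃L[ℝ] V).symm v ∈ hull ℝ (G₀ : Set V)} :=
    (isClosed_hull_finset G₀).preimage (ContinuousLinearEquiv.continuous _)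
  have hxδ : x ∈ {v : V | (δ : V ≃L[ℝ] V).symm v ∈ hull ℝ (G₀ : Set V)} := by
    refine hclosed.mem_of_frequently_of_tendsto (hfreq.mono fun n hn => ?_) hylim
    change (δ : V ≃L[ℝ] V).symm (y n) ∈ hull ℝ (G₀ : Set V)
    rw [← hzy, hn, ContinuousLinearEquiv.symm_apply_apply]
    exact hz n
  exact mem_translates.2 ⟨δ, hm ▸ hγΓ m, _, hxδ, by simp⟩

end Siegel

/-! ### The implications between the conditions. -/

section Main

variable {V : Type*} [NormedAddCommGroup V] [NormedSpace ℝ V] {C : Set V}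
  [FiniteDimensional ℝ V] [Module ℚ V] {ι : Type*} [Fintype ι] (b : Module.Basis ι ℝ V)
  {Γ : Subgroup (V ≃L[ℝ] V)}

theorem hasCoveringCone_dual_of_finitelyManyExtremeOrbits
    (hC : IsOpenNondegenerateConvexCone C) (hΓC : Stabilizes Γ C)
    (hΓL : Stabilizes Γ (Submodule.span ℤ (Set.range b) : Set V))
    (hfin : FinitelyManyExtremeOrbits C (Submodule.span ℤ (Set.range b)) Γ) :
    HasCoveringCone (dualRational (Submodule.span ℚ (Set.range b))) (openDual C)
      (contragredient Γ) := by
  obtain ⟨H, hH, hcov⟩ := exists_finset_covering_forms b hC hΓC hΓL hfin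
  refine ⟨hull ℝ (H : Set (StrongDual ℝ V)), isPolyhedralCone_hull_finset H, ?_, fun ξ hξ => ?_⟩
  · rw [rationalHull_eq_hull hC.openDual_isOpenNondegenerateConvexCone, hC.closure_openDual]
    exact Submodule.span_mono hH
  · obtain ⟨γ, hγ, h⟩ := hcov ξ hξ
    refine mem_translates.2 ⟨_, mem_contragredient.2 ⟨γ, hγ, rfl⟩, _, h, ?_⟩
    ext v
    simp

omit [Fintype ι] in
-- The covering cone is found in the bidual and pulled back by evaluation. It suffices that `C` maps
-- into its open bidual, and that points nonnegative under `C°`, or rational under all rational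
-- forms, come from the closure of `C`, or from the rational points.
theorem hasCoveringCone_of_finitelyManyExtremeOrbits_dual
    (hC : IsOpenNondegenerateConvexCone C) (hΓC : Stabilizes Γ C)
    {κ : Type*} [Fintype κ] (β : Module.Basis κ ℝ (StrongDual ℝ V))
    (hβ : dualRational (Submodule.span ℚ (Set.range b)) = Submodule.span ℚ (Set.range β))
    (hΓL : Stabilizes (contragredient Γ) (Submodule.span ℤ (Set.range β) :
      Set (StrongDual ℝ V)))
    (hfin : FinitelyManyExtremeOrbits (openDual C) (Submodule.span ℤ (Set.range β))
      (contragredient Γ)) :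
    HasCoveringCone (Submodule.span ℚ (Set.range b)) C Γ := by
  classical
  obtain ⟨H, hH, hcov⟩ := exists_finset_covering_forms β
    hC.openDual_isOpenNondegenerateConvexCone hΓC.openDual hΓL hfin
  let E : V ≃ₗ[ℝ] StrongDual ℝ (StrongDual ℝ V) :=
    LinearEquiv.ofBijective (NormedSpace.inclusionInDoubleDual ℝ V : V →ₗ[ℝ] _)
      ⟨(NormedSpace.inclusionInDoubleDualLi (E := V) ℝ).injective, fun f => by
        obtain ⟨x, hx⟩ := exists_eval_eq f
        exact ⟨x, ContinuousLinearMap.ext fun ξ => (hx ξ).symm⟩⟩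
  have hE : ∀ (f : StrongDual ℝ (StrongDual ℝ V)) (ξ : StrongDual ℝ V), ξ (E.symm f) = f ξ := fun f ξ => by
    have : E (E.symm f) ξ = f ξ := by rw [E.apply_symm_apply]
    exact this
  refine ⟨hull ℝ ((H.image E.symm : Finset V) : Set V), isPolyhedralCone_hull_finset _, ?_,
    fun x hx => ?_⟩
  · rw [rationalHull_eq_hull hC]
    refine Submodule.span_mono fun g hg => ?_
    obtain ⟨f, hf, rfl⟩ := Finset.mem_image.1 (Finset.mem_coe.1 hg)
    refine ⟨hC.mem_closure_of_forall_openDual fun ξ hξ => ?_, mem_span_rat_of_dual b fun ξ hξ => ?_⟩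
    · rw [hE]
      exact (hH hf).1 ξ hξ
    · rw [hE]
      rw [hβ] at hξ
      exact (hH hf).2 ξ hξ
  · obtain ⟨δ, hδ, h⟩ := hcov _ (hC.eval_mem_openDual_openDual hx)
    obtain ⟨γ, hγ, rfl⟩ := mem_contragredient.1 hδ
    refine mem_translates.2 ⟨γ, hγ, γ.symm x, ?_, by simp⟩
    have h1 := Submodule.mem_map_of_mem (f := E.symm.toLinearMap.restrictScalars {c : ℝ // 0 ≤ c}) h
    have h2 := Submodule.map_span (E.symm.toLinearMap.restrictScalars {c : ℝ // 0 ≤ c})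
      (H : Set (StrongDual ℝ (StrongDual ℝ V)))
    rw [h2] at h1
    have h3 : E.symm ((NormedSpace.inclusionInDoubleDual ℝ V x).comp
        (contragredientHom V γ : StrongDual ℝ V →L[ℝ] StrongDual ℝ V)) = γ.symm x := by
      rw [LinearEquiv.symm_apply_eq]
      rfl
    rw [Finset.coe_image]
    rw [← h3]
    exact h1

theorem isOfPolyhedralType_iff_hasCoveringCone (hC : IsOpenNondegenerateConvexCone C)
    (hΓC : Stabilizes Γ C) (hΓL : Stabilizes Γ (Submodule.span ℤ (Set.range b) : Set V)) :
    IsOfPolyhedralType (Submodule.span ℚ (Set.range b)) C Γ ↔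
      HasCoveringCone (Submodule.span ℚ (Set.range b)) C Γ := by
  constructor
  · rintro ⟨P, hP, hsub, h⟩
    exact ⟨P, hP, hsub, h ▸ subset_rationalHull b C hC.isOpen⟩
  · rintro ⟨P, hP, hsub, h⟩
    exact ⟨P, hP, hsub, translates_eq_rationalHull b hC hΓC hΓL hP hsub h⟩

theorem finiteExtremeOrbitsForAll_of_hasCoveringCone {VQ : Submodule ℚ V}
    (hVQ : IsRationalStructure VQ) (hC : IsOpenNondegenerateConvexCone C)
    (hΓC : Stabilizes Γ C) (h : HasCoveringCone VQ C Γ) : FiniteExtremeOrbitsForAll VQ C Γ := by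
  intro L hL hΓL
  obtain ⟨b, rfl, rfl⟩ := hL.exists_common_basis hVQ
  exact finitelyManyExtremeOrbits_of_hasCoveringCone b hC hΓC hΓL h

end Main

end PolyhedralPair

theorem mainTheorem2 {V : Type*} [NormedAddCommGroup V] [NormedSpace ℝ V]
    [FiniteDimensional ℝ V] [Module ℚ V]
    (VQ : Submodule ℚ V) (hVQ : PolyhedralPair.IsRationalStructure VQ)
    (C : Set V) (hC : PolyhedralPair.IsOpenNondegenerateConvexCone C)
    (Γ : Subgroup (V ≃L[ℝ] V)) (hΓC : PolyhedralPair.Stabilizes Γ C)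
    (hΓL : ∃ L : Submodule ℤ V,
      PolyhedralPair.IsLatticeIn VQ L ∧ PolyhedralPair.Stabilizes Γ (L : Set V)) :
    List.TFAE [
      PolyhedralPair.IsOfPolyhedralType VQ C Γ,
      PolyhedralPair.HasCoveringCone VQ C Γ,
      PolyhedralPair.FiniteExtremeOrbitsForAll VQ C Γ,
      PolyhedralPair.FiniteExtremeOrbitsForSome VQ C Γ,
      PolyhedralPair.IsOfPolyhedralType (PolyhedralPair.dualRational VQ)
        (PolyhedralPair.openDual C) (PolyhedralPair.contragredient Γ),
      PolyhedralPair.HasCoveringCone (PolyhedralPair.dualRational VQ)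
        (PolyhedralPair.openDual C) (PolyhedralPair.contragredient Γ),
      PolyhedralPair.FiniteExtremeOrbitsForAll (PolyhedralPair.dualRational VQ)
        (PolyhedralPair.openDual C) (PolyhedralPair.contragredient Γ),
      PolyhedralPair.FiniteExtremeOrbitsForSome (PolyhedralPair.dualRational VQ)
        (PolyhedralPair.openDual C) (PolyhedralPair.contragredient Γ)] ∧
    ∀ P : Set V, PolyhedralPair.IsPolyhedralCone P → P ⊆ PolyhedralPair.rationalHull VQ C →
      C ⊆ PolyhedralPair.translates Γ P →
      PolyhedralPair.translates Γ P = PolyhedralPair.rationalHull VQ C := by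
  open PolyhedralPair in
  obtain ⟨L, hL, hΓL⟩ := hΓL
  obtain ⟨b, hb, hbL⟩ := hL.exists_common_basis hVQ
  obtain ⟨β, hβ, hβL⟩ := exists_dual_common_basis b
  have hC' := hC.openDual_isOpenNondegenerateConvexCone
  have hΓC' := hΓC.openDual
  have hβ' : dualRational VQ = Submodule.span ℚ (Set.range β) := by rw [hb, hβ]
  have hVQ' : IsRationalStructure (dualRational VQ) := ⟨β, hβ'⟩
  have hΓb : Stabilizes Γ (Submodule.span ℤ (Set.range b) : Set V) := hbL ▸ hΓL
  have hΓβ : Stabilizes (contragredient Γ)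
      (Submodule.span ℤ (Set.range β) : Set (StrongDual ℝ V)) :=
    hβL ▸ stabilizes_dualLattice hΓb
  have hLβ : IsLatticeIn (dualRational VQ) (Submodule.span ℤ (Set.range β)) :=
    ⟨β, fun i => hβ' ▸ Submodule.subset_span ⟨i, rfl⟩, rfl⟩
  refine ⟨?_, fun P hP hsub hcov => ?_⟩
  · tfae_have 1 ↔ 2 := by
      rw [hb]
      exact isOfPolyhedralType_iff_hasCoveringCone b hC hΓC hΓb
    tfae_have 2 → 3 := finiteExtremeOrbitsForAll_of_hasCoveringCone hVQ hC hΓC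
    tfae_have 3 → 4 := fun h => ⟨L, hL, hΓL, h L hL hΓL⟩
    tfae_have 4 → 6 := by
      rintro ⟨M, hM, hΓM, h⟩
      -- The lattice `M` may differ from `L`, but its basis spans the same rational structure.
      obtain ⟨c, hc, rfl⟩ := hM.exists_common_basis hVQ
      rw [hc]
      exact hasCoveringCone_dual_of_finitelyManyExtremeOrbits c hC hΓC hΓM h
    tfae_have 5 ↔ 6 := by
      rw [hβ']
      exact isOfPolyhedralType_iff_hasCoveringCone β hC' hΓC' hΓβ
    tfae_have 6 → 7 := finiteExtremeOrbitsForAll_of_hasCoveringCone hVQ' hC' hΓC'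
    tfae_have 7 → 8 := fun h => ⟨_, hLβ, hΓβ, h _ hLβ hΓβ⟩
    tfae_have 8 → 2 := by
      rintro ⟨M, hM, hΓM, h⟩
      obtain ⟨c, hc, rfl⟩ := hM.exists_common_basis hVQ'
      rw [hb] at hc ⊢
      exact hasCoveringCone_of_finitelyManyExtremeOrbits_dual b hC hΓC c hc hΓM h
    tfae_finish
  · rw [hb] at hsub ⊢
    exact translates_eq_rationalHull b hC hΓC hΓb hP hsub hcov
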